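/- Let $(\widetilde M,g)$ be a smooth Riemannian manifold of dimension $2n+1$ with Levi-Civita connection $\widetilde\nabla$ and an almost contact metric structure $(\phi,\xi,\eta)$, i.e. $\eta(\xi)=1$, $\phi^2=-I+\eta\otimes\xi$, $\phi\xi=0$, $\eta\circ\phi=0$, $g(\phi X,\phi Y)=g(X,Y)-\eta(X)\eta(Y)$, $\eta(X)=g(X,\xi)$. Assume that $\widetilde M=\widetilde M(f_1,f_2,f_3)$ is a generalized Sasakian-space-form: for smooth functions $f_1,f_2,f_3$ on $\widetilde M$ its curvature tensor is $$\begin{aligned}\widetilde R(X,Y)Z={}&f_1\{g(Y,Z)X-g(X,Z)Y\}+f_2\{g(X,\phi Z)\phi Y-g(Y,\phi Z)\phi X+2g(X,\phi Y)\phi Z\}\\&+f_3\{\eta(X)\eta(Z)Y-\eta(Y)\eta(Z)X+g(X,Z)\eta(Y)\xi-g(Y,Z)\eta(X)\xi\}.\end{aligned}$$ Assume moreover that, for some functions $\alpha,\beta$ on $\widetilde M$, $$(\widetilde\nabla_X\phi)Y=\alpha\{g(X,Y)\xi-\eta(Y)X\}+\beta\{g(\phi X,Y)\xi-\eta(Y)\phi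 X\}$$ (for example $\alpha=f_1-f_3$, $\beta=0$, in which case $\widetilde\nabla_X\xi=-(f_1-f_3)\phi X$). Let $M$ be an (isometrically immersed) invariant submanifold of $\widetilde M$, i.e. $\xi$ is tangent to $M$ along $M$ and $\phi(TM)\subset TM$, and suppose that $f_1\neq f_3$ at every point of $M$. Let $\nabla$ and $S$ be the Levi-Civita connection and the Ricci tensor of $M$, $\nabla^\perp$ its normal connection, $\sigma(X,Y)=\widetilde\nabla_XY-\nabla_XY$ its second fundamental form, and $$(\widetilde\nabla\sigma)(X,Y,Z)=(\widetilde\nabla_X\sigma)(Y,Z)=\nabla^\perp_X(\sigma(Y,Z))-\sigma(\nabla_XY,Z)-\sigma(Y,\nabla_XZ).$$ For a tensor $T$ with $k$ arguments put $$Q(S,T)(X_1,\dots,X_k;U,V)=-\sum_{i=1}^kT(X_1,\dots,(U\wedge_SV)X_i,\dots,X_k),\qquad (U\wedge_SV)X=S(V,X)U-S(U,X)V.$$ Then $M$ is totally geodesic (that is, $\sigma=0$) if and only if $Q(S,\widetilde\nabla\sigma)=0$. This holds in both readings of the condition: with $\widetilde\nabla\sigma$ regarded as a tensor with three arguments, and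 with $Q(S,\widetilde\nabla_X\sigma)=0$ for every $X$ tangent to $M$, where $\widetilde\nabla_X\sigma$ has two arguments. -/

import Mathlib

open Bundle FiberBundle
open scoped Manifold ContDiff

noncomputable section

/-! ## Affine connections and curvature -/

section Connection

variable {d : ℕ} {N : Type*} [TopologicalSpace N] [ChartedSpace (EuclideanSpace ℝ (Fin d)) N]
  [IsManifold (𝓡 d) ∞ N]

instance instFiniteDimensionalTangent (p : N) : FiniteDimensional ℝ (TangentSpace (𝓡 d) p) :=
  inferInstanceAs (FiniteDimensional ℝ (EuclideanSpace ℝ (Fin d)))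

/-- Affine connections on a `d`-dimensional manifold, i.e. covariant derivatives on its tangent
bundle. In Mathlib's convention `cov Y p v` is `(∇_v Y)(p)`. -/
abbrev AffineConnection (d : ℕ) (N : Type*) [TopologicalSpace N]
    [ChartedSpace (EuclideanSpace ℝ (Fin d)) N] [IsManifold (𝓡 d) ∞ N] :=
  CovariantDerivative (𝓡 d) (EuclideanSpace ℝ (Fin d)) (fun p : N ↦ TangentSpace (𝓡 d) p)

/-- Extension of a tangent vector at `p` to a vector field which is smooth near `p` (it is constant
in the standard trivialization around `p`). The tensors below are evaluated on tangent vectors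
through such extensions; being tensorial, they do not depend on the extension. -/
abbrev extendVec {p : N} (v : TangentSpace (𝓡 d) p) (q : N) : TangentSpace (𝓡 d) q :=
  extend (EuclideanSpace ℝ (Fin d)) (E := fun p : N ↦ TangentSpace (𝓡 d) p) v q

/-- `R(X, Y)Z = ∇_X ∇_Y Z - ∇_Y ∇_X Z - ∇_{[X, Y]} Z` for vector fields `X, Y, Z`. -/
def curvatureField (cov : AffineConnection d N)
    (X Y Z : Π p : N, TangentSpace (𝓡 d) p) (p : N) : TangentSpace (𝓡 d) p :=
  cov (fun q ↦ cov Z q (Y q)) p (X p) - cov (fun q ↦ cov Z q (X q)) p (Y p)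
    - cov Z p (VectorField.mlieBracket (𝓡 d) X Y p)

/-- The curvature tensor `R(u, v)w` at a point. -/
def curvature (cov : AffineConnection d N) (p : N) (u v w : TangentSpace (𝓡 d) p) :
    TangentSpace (𝓡 d) p :=
  curvatureField cov (extendVec u) (extendVec v) (extendVec w) p

/-- `(∇_v φ)w = ∇_v (φ W) - φ (∇_v W)` (`W` extending `w`), for a `(1,1)`-tensor field `φ`. -/
def covDerivEndo (cov : AffineConnection d N)
    (φ : Π p : N, TangentSpace (𝓡 d) p →L[ℝ] TangentSpace (𝓡 d) p) (p : N)
    (v w : TangentSpace (𝓡 d) p) : TangentSpace (𝓡 d) p :=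
  cov (fun q ↦ φ q (extendVec w q)) p v - φ p (cov (extendVec w) p v)

end Connection

section Riemannian

variable {d : ℕ} {N : Type*} [TopologicalSpace N] [ChartedSpace (EuclideanSpace ℝ (Fin d)) N]
  [IsManifold (𝓡 d) ∞ N]
  [RiemannianBundle (fun p : N ↦ TangentSpace (𝓡 d) p)]
  [IsContMDiffRiemannianBundle (𝓡 d) ∞ (EuclideanSpace ℝ (Fin d))
    (fun p : N ↦ TangentSpace (𝓡 d) p)]

/-- `cov` is the Levi-Civita connection: it is compatible with the metric and torsion-free. -/
def IsLeviCivita (cov : AffineConnection d N) : Prop :=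
  haveI : IsContMDiffRiemannianBundle (𝓡 d) 1 (EuclideanSpace ℝ (Fin d))
      (fun p : N ↦ TangentSpace (𝓡 d) p) :=
    IsContMDiffRiemannianBundle.of_le (n := ∞) (by exact_mod_cast le_top)
  cov.IsMetricCompatible ∧ cov.torsion = 0

/-- The Ricci tensor `S(v, w) = ∑ᵢ g(R(eᵢ, v)w, eᵢ)`, `(eᵢ)` an orthonormal basis of the tangent
space. -/
def ricci (cov : AffineConnection d N) (p : N) (v w : TangentSpace (𝓡 d) p) : ℝ :=
  ∑ i, inner ℝ (curvature cov p (stdOrthonormalBasis ℝ (TangentSpace (𝓡 d) p) i) v w)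
    (stdOrthonormalBasis ℝ (TangentSpace (𝓡 d) p) i)

end Riemannian

/-! ## Almost contact metric manifolds and generalized Sasakian-space-forms -/

section Contact

variable (d : ℕ) (N : Type*) [TopologicalSpace N] [ChartedSpace (EuclideanSpace ℝ (Fin d)) N]
  [IsManifold (𝓡 d) ∞ N]
  [RiemannianBundle (fun p : N ↦ TangentSpace (𝓡 d) p)]

/-- An almost contact metric structure `(φ, ξ, η)` on a Riemannian manifold. -/
structure AlmostContactMetricStructure where
  φ : Π p : N, TangentSpace (𝓡 d) p →L[ℝ] TangentSpace (𝓡 d) p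
  ξ : Π p : N, TangentSpace (𝓡 d) p
  η : Π p : N, TangentSpace (𝓡 d) p →L[ℝ] ℝ
  smooth_φ : ContMDiff (𝓡 d)
    ((𝓡 d).prod 𝓘(ℝ, EuclideanSpace ℝ (Fin d) →L[ℝ] EuclideanSpace ℝ (Fin d))) ∞
    (fun p ↦ TotalSpace.mk' (EuclideanSpace ℝ (Fin d) →L[ℝ] EuclideanSpace ℝ (Fin d))
      (E := fun p : N ↦ TangentSpace (𝓡 d) p →L[ℝ] TangentSpace (𝓡 d) p) p (φ p))
  smooth_ξ : ContMDiff (𝓡 d) ((𝓡 d).prod 𝓘(ℝ, EuclideanSpace ℝ (Fin d))) ∞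
    (fun p ↦ TotalSpace.mk' (EuclideanSpace ℝ (Fin d))
      (E := fun p : N ↦ TangentSpace (𝓡 d) p) p (ξ p))
  smooth_η : ContMDiff (𝓡 d) ((𝓡 d).prod 𝓘(ℝ, EuclideanSpace ℝ (Fin d) →L[ℝ] ℝ)) ∞
    (fun p ↦ TotalSpace.mk' (EuclideanSpace ℝ (Fin d) →L[ℝ] ℝ)
      (E := fun p : N ↦ TangentSpace (𝓡 d) p →L[ℝ] ℝ) p (η p))
  η_ξ : ∀ p, η p (ξ p) = 1
  φ_φ : ∀ p v, φ p (φ p v) = -v + η p v • ξ p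
  φ_ξ : ∀ p, φ p (ξ p) = 0
  η_φ : ∀ p v, η p (φ p v) = 0
  inner_φ_φ : ∀ p v w, inner ℝ (φ p v) (φ p w) = inner ℝ v w - η p v * η p w
  η_eq : ∀ p v, η p v = inner ℝ v (ξ p)

end Contact

namespace AlmostContactMetricStructure

variable {d : ℕ} {N : Type*} [TopologicalSpace N] [ChartedSpace (EuclideanSpace ℝ (Fin d)) N]
  [IsManifold (𝓡 d) ∞ N]
  [RiemannianBundle (fun p : N ↦ TangentSpace (𝓡 d) p)]

/-- The curvature of `cov` has the form which defines a generalized Sasakian-space-form with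
(smooth) functions `f₁, f₂, f₃`. -/
structure IsGeneralizedSasakianSpaceForm (A : AlmostContactMetricStructure d N)
    (cov : AffineConnection d N) (f₁ f₂ f₃ : N → ℝ) : Prop where
  smooth₁ : ContMDiff (𝓡 d) 𝓘(ℝ) ∞ f₁
  smooth₂ : ContMDiff (𝓡 d) 𝓘(ℝ) ∞ f₂
  smooth₃ : ContMDiff (𝓡 d) 𝓘(ℝ) ∞ f₃
  curvature_eq : ∀ (p : N) (X Y Z : TangentSpace (𝓡 d) p), curvature cov p X Y Z =
    f₁ p • (inner ℝ Y Z • X - inner ℝ X Z • Y)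
    + f₂ p • (inner ℝ X (A.φ p Z) • A.φ p Y - inner ℝ Y (A.φ p Z) • A.φ p X
        + (2 * inner ℝ X (A.φ p Y)) • A.φ p Z)
    + f₃ p • ((A.η p X * A.η p Z) • Y - (A.η p Y * A.η p Z) • X
        + (inner ℝ X Z * A.η p Y) • A.ξ p - (inner ℝ Y Z * A.η p X) • A.ξ p)

/-- The structure is trans-Sasakian, of some type `(α, β)`:
`(∇_X φ)Y = α (g(X, Y)ξ - η(Y)X) + β (g(φX, Y)ξ - η(Y)φX)`. -/
def IsTransSasakian (A : AlmostContactMetricStructure d N) (cov : AffineConnection d N) : Prop :=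
  ∃ α β : N → ℝ, ∀ (p : N) (X Y : TangentSpace (𝓡 d) p), covDerivEndo cov A.φ p X Y =
    α p • (inner ℝ X Y • A.ξ p - A.η p Y • X)
    + β p • (inner ℝ (A.φ p X) Y • A.ξ p - A.η p Y • A.φ p X)

end AlmostContactMetricStructure

/-! ## Submanifolds -/

/-- The component of `w` orthogonal to the subspace `K`. -/
def orthogonalPart {F : Type*} [NormedAddCommGroup F] [InnerProductSpace ℝ F]
    [FiniteDimensional ℝ F] (K : Submodule ℝ F) (w : F) : F :=
  Kᗮ.starProjection w

section Submanifold

variable {d m : ℕ}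
  {N : Type*} [TopologicalSpace N] [ChartedSpace (EuclideanSpace ℝ (Fin d)) N]
  [IsManifold (𝓡 d) ∞ N]
  {M : Type*} [TopologicalSpace M] [ChartedSpace (EuclideanSpace ℝ (Fin m)) M]
  [IsManifold (𝓡 m) ∞ M]

/-- The derivative `∇̃_v V` along `f : M → N` of a vector field `V` along `f`, for an affine
connection on `N` (the pulled-back connection): in the trivialization of `TN` around `f x` one
differentiates the components of `V`, and adds the covariant derivative along `df(v)` of the field
with constant components equal to those of `V x`. For `V = Y ∘ f` it is `∇̃_{df(v)} Y`. -/
def covAlong (cov : AffineConnection d N) (f : M → N) (V : Π x : M, TangentSpace (𝓡 d) (f x))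
    (x : M) (v : TangentSpace (𝓡 m) x) : TangentSpace (𝓡 d) (f x) :=
  (trivializationAt (EuclideanSpace ℝ (Fin d)) (fun p : N ↦ TangentSpace (𝓡 d) p) (f x)).symm (f x)
    (mvfderiv (𝓡 m) (fun y ↦ (trivializationAt (EuclideanSpace ℝ (Fin d))
      (fun p : N ↦ TangentSpace (𝓡 d) p) (f x) ⟨f y, V y⟩).2) x v)
  + cov (extendVec (V x)) (f x) (mfderiv (𝓡 m) (𝓡 d) f x v)

/-- The tangent space of the submanifold `f : M → N`, as a subspace of the ambient one. -/
def tangentRange (f : M → N) (x : M) : Submodule ℝ (TangentSpace (𝓡 d) (f x)) :=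
  (mfderiv (𝓡 m) (𝓡 d) f x).range

variable [RiemannianBundle (fun p : N ↦ TangentSpace (𝓡 d) p)]

/-- The component of an ambient vector which is normal to the submanifold. -/
def normalPart (f : M → N) (x : M) (w : TangentSpace (𝓡 d) (f x)) : TangentSpace (𝓡 d) (f x) :=
  orthogonalPart (F := TangentSpace (𝓡 d) (f x)) (tangentRange (m := m) f x) w

/-- The second fundamental form `σ(u, v)`: the normal component of `∇̃_u (df V)`, with `V` a vector
field of `M` extending `v`. -/
def secondFundamentalForm (cov : AffineConnection d N) (f : M → N) (x : M)
    (u v : TangentSpace (𝓡 m) x) : TangentSpace (𝓡 d) (f x) :=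
  normalPart (m := m) f x (covAlong cov f (fun y ↦ mfderiv (𝓡 m) (𝓡 d) f y (extendVec v y)) x u)

/-- The normal connection `∇^⊥_v V`, for a normal vector field `V` along `f`. -/
def normalCov (cov : AffineConnection d N) (f : M → N) (V : Π x : M, TangentSpace (𝓡 d) (f x))
    (x : M) (v : TangentSpace (𝓡 m) x) : TangentSpace (𝓡 d) (f x) :=
  normalPart (m := m) f x (covAlong cov f V x v)

/-- The covariant derivative of the second fundamental form,
`(∇̃_u σ)(v, w) = ∇^⊥_u (σ(V, W)) - σ(∇_u V, w) - σ(v, ∇_u W)`, with `V, W` extending `v, w`;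
here `covM` is the connection `∇` of `M`, and `covN` the connection `∇̃` of `N`. -/
def covDerivSecond (covN : AffineConnection d N) (covM : AffineConnection m M) (f : M → N) (x : M)
    (u v w : TangentSpace (𝓡 m) x) : TangentSpace (𝓡 d) (f x) :=
  normalCov covN f
      (fun y ↦ secondFundamentalForm covN f y (extendVec v y) (extendVec w y)) x u
    - secondFundamentalForm covN f x (covM (extendVec v) x u) w
    - secondFundamentalForm covN f x v (covM (extendVec w) x u)

/-- `f` is an isometric immersion (isometric smooth maps are automatically immersions). -/
def IsIsometricImmersion [RiemannianBundle (fun x : M ↦ TangentSpace (𝓡 m) x)]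
    (f : M → N) : Prop :=
  ContMDiff (𝓡 m) (𝓡 d) ∞ f ∧ ∀ (x : M) (u v : TangentSpace (𝓡 m) x),
    inner ℝ (mfderiv (𝓡 m) (𝓡 d) f x u) (mfderiv (𝓡 m) (𝓡 d) f x v) = inner ℝ u v

/-- The submanifold is invariant: `ξ` is tangent to it, and `φ` maps tangent vectors to tangent
vectors. -/
def IsInvariantSubmanifold (A : AlmostContactMetricStructure d N) (f : M → N) : Prop :=
  ∀ x : M, A.ξ (f x) ∈ tangentRange (m := m) f x ∧
    ∀ w ∈ tangentRange (m := m) f x, A.φ (f x) w ∈ tangentRange (m := m) f x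

/-- The submanifold is totally geodesic: its second fundamental form vanishes. -/
def IsTotallyGeodesic (cov : AffineConnection d N) (f : M → N) : Prop :=
  ∀ (x : M) (u v : TangentSpace (𝓡 m) x), secondFundamentalForm cov f x u v = 0

end Submanifold

/-! ## The operation `Q(E, T)` -/

section Tachibana

variable {V W : Type*} [AddCommGroup V] [Module ℝ V] [AddCommGroup W]

/-- `(X ∧_E Y)Z = E(Y, Z)X - E(X, Z)Y`. -/
def wedgeEndo (E : V → V → ℝ) (X Y Z : V) : V := E Y Z • X - E X Z • Y

/-- `Q(E, T)(X₁, …, X_k; X, Y) = - ∑ᵢ T(X₁, …, (X ∧_E Y)Xᵢ, …, X_k)`. -/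
def tachibanaQ {k : ℕ} (E : V → V → ℝ) (T : (Fin k → V) → W) (Z : Fin k → V) (X Y : V) : W :=
  - ∑ i, T (Function.update Z i (wedgeEndo E X Y (Z i)))

end Tachibana

end

open Bundle FiberBundle
open scoped Manifold ContDiff
open Filter Topology

/-! Let `Z` be the tangent field of $M$ with $df(Z)=\xi$. Applying $\phi$ to
$(\widetilde\nabla_X\phi)\xi=-\phi\widetilde\nabla_X\xi$ gives
$\widetilde\nabla_X\xi=\beta(X-\eta(X)\xi)-\alpha\phi X$ (`cov_ξ`). On an invariant submanifold this
is tangent, so the Gauss formula yields $\sigma(X,\xi)=0$ and $\nabla_X\xi=\widetilde\nabla_X\xi$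
(`secondFundamentalForm_lift`). Two consequences follow:
$(\widetilde\nabla_X\sigma)(Y,\xi)=-\sigma(Y,\nabla_X\xi)$ (`covDerivSecond_lift`), and
$R(X,Y)\xi=(f_1-f_3)(\eta(Y)X-\eta(X)Y)$ on $M$, whose trace is $S(X,\xi)=(m-1)(f_1-f_3)\eta(X)$
(`curvature_lift`, `ricci_lift`).

Evaluating $Q(S,\widetilde\nabla\sigma)=0$ on $(v,\xi,\xi;u,\xi)$ therefore leaves
$(m-1)(f_1-f_3)\,\sigma(u,\nabla_v\xi)=0$ up to a factor; for $m=1$ the tangent space is spanned by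
$\xi$ and $\sigma=0$ anyway (`secondFundamentalForm_cov_lift`). Inserting $v$ and $\phi v$ in
$\sigma(u,\nabla_v\xi)=0$ gives $(\alpha^2+\beta^2)\sigma=0$. If $\sigma\ne0$ at a point, then
$\sigma\neq 0$ nearby, so $\alpha=\beta=0$ nearby and $\xi$ is parallel there. Then
$0=R(u,\xi)\xi=(f_1-f_3)(u-\eta(u)\xi)$, so $\xi$ spans the tangent space and $\sigma=0$, a
contradiction (`secondFundamentalForm_eq_zero`). No relation between $\alpha,\beta$ and $f_1-f_3$ is
needed.

The rest supplies the classical calculus. Curvature, $\sigma$ and $\widetilde\nabla\sigma$ are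
defined through one particular extension of vectors, whereas the argument extends $\xi$ by itself.
Independence of the extension is proved in charts: `tcoord_cov`, `curvature_eq`, `tcoord_covAlong`,
`tcoord_secondFundamentalForm`, `covDerivSecond_eq`. -/

noncomputable section

/-! ### Vector fields and derivatives in a chart. -/

section LocalRepresentation

variable {d : ℕ} {N : Type*} [TopologicalSpace N] [ChartedSpace (EuclideanSpace ℝ (Fin d)) N]
  [IsManifold (𝓡 d) ∞ N]

/-- The coordinates of a tangent vector at `q` in the trivialization around `p`. -/
def tcoord (p q : N) : TangentSpace (𝓡 d) q →L[ℝ] EuclideanSpace ℝ (Fin d) :=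
  (trivializationAt (EuclideanSpace ℝ (Fin d))
    (fun p : N ↦ TangentSpace (𝓡 d) p) p).continuousLinearMapAt ℝ q

/-- The tangent vector at `q` with given coordinates in the trivialization around `p`. -/
def tvec (p q : N) : EuclideanSpace ℝ (Fin d) →L[ℝ] TangentSpace (𝓡 d) q :=
  (trivializationAt (EuclideanSpace ℝ (Fin d)) (fun p : N ↦ TangentSpace (𝓡 d) p) p).symmL ℝ q

/-- The component function of a vector field in the chart around `p`. -/
def locField (p : N) (W : Π q : N, TangentSpace (𝓡 d) q) (a : EuclideanSpace ℝ (Fin d)) :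
    EuclideanSpace ℝ (Fin d) :=
  tcoord p ((extChartAt (𝓡 d) p).symm a) (W ((extChartAt (𝓡 d) p).symm a))

variable {p q : N}

lemma mem_baseSet_of_mem_source (hq : q ∈ (extChartAt (𝓡 d) p).source) :
    q ∈ (trivializationAt (EuclideanSpace ℝ (Fin d))
      (fun p : N ↦ TangentSpace (𝓡 d) p) p).baseSet := by
  simpa using hq

lemma tcoord_tvec (hq : q ∈ (extChartAt (𝓡 d) p).source) (v : EuclideanSpace ℝ (Fin d)) :
    tcoord p q (tvec p q v) = v :=
  Trivialization.continuousLinearMapAt_symmL _ (mem_baseSet_of_mem_source hq) v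

lemma tvec_tcoord (hq : q ∈ (extChartAt (𝓡 d) p).source) (v : TangentSpace (𝓡 d) q) :
    tvec p q (tcoord p q v) = v :=
  Trivialization.symmL_continuousLinearMapAt _ (mem_baseSet_of_mem_source hq) v

lemma tcoord_injective (hq : q ∈ (extChartAt (𝓡 d) p).source) :
    Function.Injective (tcoord (d := d) p q) :=
  Function.LeftInverse.injective (tvec_tcoord hq)

lemma trivializationAt_snd (hq : q ∈ (extChartAt (𝓡 d) p).source) (v : TangentSpace (𝓡 d) q) :
    (trivializationAt (EuclideanSpace ℝ (Fin d)) (fun p : N ↦ TangentSpace (𝓡 d) p) p ⟨q, v⟩).2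
      = tcoord p q v := by
  rw [tcoord, Trivialization.continuousLinearMapAt_apply,
    Trivialization.coe_linearMapAt_of_mem _ (mem_baseSet_of_mem_source hq)]

lemma extendVec_eq (v : TangentSpace (𝓡 d) p) (hq : q ∈ (extChartAt (𝓡 d) p).source) :
    extendVec v q = tvec p q (tcoord p p v) := by
  simp only [extendVec, extend]
  rw [trivializationAt_snd (mem_extChartAt_source p), tvec,
    Trivialization.symmL_apply _ (mem_baseSet_of_mem_source hq)]

@[simp]
lemma extendVec_self (v : TangentSpace (𝓡 d) p) : extendVec v p = v :=
  extend_apply_self _ v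

lemma tcoord_extendVec (v : TangentSpace (𝓡 d) p) (hq : q ∈ (extChartAt (𝓡 d) p).source) :
    tcoord p q (extendVec v q) = tcoord p p v := by
  rw [extendVec_eq v hq, tcoord_tvec hq]

lemma tcoord_eq_mfderiv (hq : q ∈ (extChartAt (𝓡 d) p).source) :
    tcoord p q = mfderiv (𝓡 d) 𝓘(ℝ, EuclideanSpace ℝ (Fin d)) (extChartAt (𝓡 d) p) q :=
  TangentBundle.continuousLinearMapAt_trivializationAt (by simpa using hq)

variable {F : Type*} [NormedAddCommGroup F] [NormedSpace ℝ F]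

lemma mdifferentiableAt_extChartAt_symm {a : EuclideanSpace ℝ (Fin d)}
    (ha : a ∈ (extChartAt (𝓡 d) p).target) :
    MDifferentiableAt 𝓘(ℝ, EuclideanSpace ℝ (Fin d)) (𝓡 d) (extChartAt (𝓡 d) p).symm a := by
  rw [← mdifferentiableWithinAt_univ]
  simpa only [modelWithCornersSelf_coe, Set.range_id] using
    mdifferentiableWithinAt_extChartAt_symm (I := 𝓡 d) ha

lemma contMDiffAt_iff_contDiffAt_comp_symm {n : ℕ∞ω} (hn : n ≤ ∞) {g : N → F}
    (hq : q ∈ (extChartAt (𝓡 d) p).source) :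
    ContMDiffAt (𝓡 d) 𝓘(ℝ, F) n g q ↔
      ContDiffAt ℝ n (g ∘ (extChartAt (𝓡 d) p).symm) (extChartAt (𝓡 d) p q) := by
  rw [← contMDiffAt_iff_contDiffAt]
  have hl := (extChartAt (𝓡 d) p).left_inv hq
  constructor
  · intro h
    refine ContMDiffAt.comp_of_eq h ?_ hl
    have := (contMDiffOn_extChartAt_symm (I := 𝓡 d) (n := ∞) p).contMDiffAt
      ((isOpen_extChartAt_target p).mem_nhds ((extChartAt (𝓡 d) p).map_source hq))
    exact this.of_le hn
  · intro h
    have hc : ContMDiffAt (𝓡 d) 𝓘(ℝ, EuclideanSpace ℝ (Fin d)) n (extChartAt (𝓡 d) p) q :=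
      (contMDiffAt_extChartAt' (I := 𝓡 d) (n := ∞) (by simpa using hq)).of_le hn
    refine (ContMDiffAt.comp q h hc).congr_of_eventuallyEq ?_
    filter_upwards [extChartAt_source_mem_nhds' hq] with y hy
    simp only [Function.comp_apply, (extChartAt (𝓡 d) p).left_inv hy]

lemma mdifferentiableAt_iff_differentiableAt_comp_symm {g : N → F}
    (hq : q ∈ (extChartAt (𝓡 d) p).source) :
    MDifferentiableAt (𝓡 d) 𝓘(ℝ, F) g q ↔
      DifferentiableAt ℝ (g ∘ (extChartAt (𝓡 d) p).symm) (extChartAt (𝓡 d) p q) := by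
  rw [← mdifferentiableAt_iff_differentiableAt]
  have hl := (extChartAt (𝓡 d) p).left_inv hq
  constructor
  · intro h
    refine MDifferentiableAt.comp_of_eq (extChartAt (𝓡 d) p q) h ?_ hl
    exact mdifferentiableAt_extChartAt_symm ((extChartAt (𝓡 d) p).map_source hq)
  · intro h
    refine (MDifferentiableAt.comp q h
      (mdifferentiableAt_extChartAt (by simpa using hq))).congr_of_eventuallyEq ?_
    filter_upwards [extChartAt_source_mem_nhds' hq] with y hy
    simp only [Function.comp_apply, (extChartAt (𝓡 d) p).left_inv hy]

lemma mvfderiv_eq_fderiv {g : N → F} (hq : q ∈ (extChartAt (𝓡 d) p).source)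
    (hg : MDifferentiableAt (𝓡 d) 𝓘(ℝ, F) g q) (u : TangentSpace (𝓡 d) q) :
    mvfderiv (𝓡 d) g q u = fderiv ℝ (g ∘ (extChartAt (𝓡 d) p).symm) (extChartAt (𝓡 d) p q)
      (tcoord p q u) := by
  have h1 := ((mdifferentiableAt_iff_differentiableAt_comp_symm hq).1 hg).hasFDerivAt.hasMFDerivAt
  have h2 : HasMFDerivAt (𝓡 d) 𝓘(ℝ, EuclideanSpace ℝ (Fin d)) (extChartAt (𝓡 d) p) q
      (tcoord p q) := by
    rw [tcoord_eq_mfderiv hq]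
    exact (mdifferentiableAt_extChartAt (by simpa using hq)).hasMFDerivAt
  have h3 : HasMFDerivAt (𝓡 d) 𝓘(ℝ, F) g q _ := (h1.comp q h2).congr_of_eventuallyEq (by
    filter_upwards [extChartAt_source_mem_nhds' hq] with y hy
    simp only [Function.comp_apply, (extChartAt (𝓡 d) p).left_inv hy])
  simp only [mvfderiv]
  rw [h3.mfderiv]
  rfl

lemma eventually_trivializationAt_eq (W : Π q : N, TangentSpace (𝓡 d) q)
    (hq : q ∈ (extChartAt (𝓡 d) p).source) :
    (fun q ↦ (trivializationAt (EuclideanSpace ℝ (Fin d))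
      (fun p : N ↦ TangentSpace (𝓡 d) p) p ⟨q, W q⟩).2) =ᶠ[𝓝 q] fun q ↦ tcoord p q (W q) := by
  filter_upwards [extChartAt_source_mem_nhds' hq] with y hy
  exact trivializationAt_snd hy _

lemma contMDiffAt_field_iff {W : Π q : N, TangentSpace (𝓡 d) q}
    (hq : q ∈ (extChartAt (𝓡 d) p).source) :
    ContMDiffAt (𝓡 d) ((𝓡 d).prod 𝓘(ℝ, EuclideanSpace ℝ (Fin d))) ∞ (T% W) q ↔
      ContDiffAt ℝ ∞ (locField p W) (extChartAt (𝓡 d) p q) := by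
  rw [Trivialization.contMDiffAt_section_iff
    (trivializationAt (EuclideanSpace ℝ (Fin d)) (fun p : N ↦ TangentSpace (𝓡 d) p) p)
    (mem_baseSet_of_mem_source hq), (eventually_trivializationAt_eq W hq).contMDiffAt_iff,
    contMDiffAt_iff_contDiffAt_comp_symm le_rfl hq]
  rfl

lemma mdifferentiableAt_field_iff {W : Π q : N, TangentSpace (𝓡 d) q}
    (hq : q ∈ (extChartAt (𝓡 d) p).source) :
    MDifferentiableAt (𝓡 d) ((𝓡 d).prod 𝓘(ℝ, EuclideanSpace ℝ (Fin d))) (T% W) q ↔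
      DifferentiableAt ℝ (locField p W) (extChartAt (𝓡 d) p q) := by
  rw [Trivialization.mdifferentiableAt_section_iff _
    (trivializationAt (EuclideanSpace ℝ (Fin d)) (fun p : N ↦ TangentSpace (𝓡 d) p) p) _
    (mem_baseSet_of_mem_source hq), (eventually_trivializationAt_eq W hq).mdifferentiableAt_iff,
    mdifferentiableAt_iff_differentiableAt_comp_symm hq]
  rfl

lemma locField_apply (W : Π q : N, TangentSpace (𝓡 d) q)
    (hq : q ∈ (extChartAt (𝓡 d) p).source) :
    locField p W (extChartAt (𝓡 d) p q) = tcoord p q (W q) := by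
  simp only [locField]
  rw [(extChartAt (𝓡 d) p).left_inv hq]

lemma locField_tvec_eventuallyEq (v : EuclideanSpace ℝ (Fin d)) {a : EuclideanSpace ℝ (Fin d)}
    (ha : a ∈ (extChartAt (𝓡 d) p).target) :
    locField p (fun q ↦ tvec p q v) =ᶠ[𝓝 a] fun _ ↦ v := by
  filter_upwards [(isOpen_extChartAt_target p).mem_nhds ha] with b hb
  exact tcoord_tvec ((extChartAt (𝓡 d) p).map_target hb) v

lemma contMDiffAt_tvec (v : EuclideanSpace ℝ (Fin d)) (hq : q ∈ (extChartAt (𝓡 d) p).source) :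
    ContMDiffAt (𝓡 d) ((𝓡 d).prod 𝓘(ℝ, EuclideanSpace ℝ (Fin d))) ∞
      (T% (fun q ↦ tvec (d := d) p q v)) q := by
  rw [contMDiffAt_field_iff hq]
  exact contDiffAt_const.congr_of_eventuallyEq
    (locField_tvec_eventuallyEq v ((extChartAt (𝓡 d) p).map_source hq))

lemma mdifferentiableAt_tvec (v : EuclideanSpace ℝ (Fin d))
    (hq : q ∈ (extChartAt (𝓡 d) p).source) :
    MDifferentiableAt (𝓡 d) ((𝓡 d).prod 𝓘(ℝ, EuclideanSpace ℝ (Fin d)))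
      (T% (fun q ↦ tvec (d := d) p q v)) q :=
  (contMDiffAt_tvec v hq).mdifferentiableAt (by simp)

lemma locField_extendVec_eventuallyEq (v : TangentSpace (𝓡 d) p)
    {a : EuclideanSpace ℝ (Fin d)} (ha : a ∈ (extChartAt (𝓡 d) p).target) :
    locField p (extendVec v) =ᶠ[𝓝 a] fun _ ↦ tcoord p p v := by
  filter_upwards [(isOpen_extChartAt_target p).mem_nhds ha] with b hb
  exact tcoord_extendVec v ((extChartAt (𝓡 d) p).map_target hb)

lemma contMDiffAt_extendVec (v : TangentSpace (𝓡 d) p) (hq : q ∈ (extChartAt (𝓡 d) p).source) :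
    ContMDiffAt (𝓡 d) ((𝓡 d).prod 𝓘(ℝ, EuclideanSpace ℝ (Fin d))) ∞ (T% (extendVec v)) q := by
  rw [contMDiffAt_field_iff hq]
  exact contDiffAt_const.congr_of_eventuallyEq
    (locField_extendVec_eventuallyEq v ((extChartAt (𝓡 d) p).map_source hq))

end LocalRepresentation

/-! ### Connections and curvature on a vector space. -/

section LocalConnection

variable {E : Type*} [NormedAddCommGroup E] [NormedSpace ℝ E]

/-- The covariant derivative in the direction `v` on a vector space, with Christoffel
symbols `Γ`. -/
def locCov (Γ : E → E →L[ℝ] E →L[ℝ] E) (w : E → E) (v a : E) : E := fderiv ℝ w a v + Γ a v (w a)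

/-- The curvature operator of `locCov`. -/
def locCurv (Γ : E → E →L[ℝ] E →L[ℝ] E) (w : E → E) (u v a : E) : E :=
  locCov Γ (locCov Γ w v) u a - locCov Γ (locCov Γ w u) v a

variable {Γ : E → E →L[ℝ] E →L[ℝ] E} {w : E → E} {a : E}

set_option synthInstance.maxHeartbeats 200000 in
lemma hasFDerivAt_locCov (hΓ : DifferentiableAt ℝ Γ a) (hw : ContDiffAt ℝ 2 w a) (v u : E) :
    DifferentiableAt ℝ (locCov Γ w v) a ∧ fderiv ℝ (locCov Γ w v) a u =
      fderiv ℝ (fderiv ℝ w) a u v + (fderiv ℝ Γ a u v (w a) + Γ a v (fderiv ℝ w a u)) := by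
  have h1 : HasFDerivAt (fderiv ℝ w) (fderiv ℝ (fderiv ℝ w) a) a :=
    ((hw.fderiv_right (m := 1) (by norm_num)).differentiableAt one_ne_zero).hasFDerivAt
  have h2 := (hw.differentiableAt two_ne_zero).hasFDerivAt
  have h3 := (h1.clm_apply (hasFDerivAt_const v a)).add
    ((hΓ.hasFDerivAt.clm_apply (hasFDerivAt_const v a)).clm_apply h2)
  refine ⟨h3.differentiableAt, ?_⟩
  have h4 := h3.fderiv
  change fderiv ℝ (locCov Γ w v) a = _ at h4
  rw [h4]
  simp only [add_apply, ContinuousLinearMap.comp_apply, ContinuousLinearMap.flip_apply,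
    ContinuousLinearMap.comp_zero, zero_add]
  abel

/-- The first derivatives of `w` enter symmetrically in `u` and `v`, and so does the second
derivative of a $C^2$ map; both cancel in the commutator and only the value `w a` survives. -/
lemma locCurv_eq_const (hΓ : DifferentiableAt ℝ Γ a) (hw : ContDiffAt ℝ 2 w a) (u v : E) :
    locCurv Γ w u v a = locCurv Γ (fun _ ↦ w a) u v a := by
  have hs := (hw.isSymmSndFDerivAt (by simp)).eq u v
  have key {w : E → E} (hw : ContDiffAt ℝ 2 w a) (u v : E) : locCov Γ (locCov Γ w v) u a =
      fderiv ℝ (fderiv ℝ w) a u v + (fderiv ℝ Γ a u v (w a) + Γ a v (fderiv ℝ w a u))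
        + Γ a u (fderiv ℝ w a v + Γ a v (w a)) := by
    rw [locCov, (hasFDerivAt_locCov hΓ hw v u).2, locCov]
  have hc : fderiv ℝ (fun _ : E ↦ w a) = 0 := by
    funext x
    simp
  rw [locCurv, locCurv, key hw, key hw, key contDiffAt_const, key contDiffAt_const, hs, hc]
  simp only [fderiv_zero, Pi.zero_apply, zero_apply, map_zero, map_add]
  abel

end LocalConnection

/-! ### Christoffel symbols; curvature is independent of the extension. -/

section Christoffel

variable {d : ℕ} {N : Type*} [TopologicalSpace N] [ChartedSpace (EuclideanSpace ℝ (Fin d)) N]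
  [IsManifold (𝓡 d) ∞ N]

/-- The Christoffel symbols of an affine connection in the chart around `p`. -/
def christoffel (cov : AffineConnection d N) (p : N) (a : EuclideanSpace ℝ (Fin d)) :
    EuclideanSpace ℝ (Fin d) →L[ℝ] EuclideanSpace ℝ (Fin d) →L[ℝ] EuclideanSpace ℝ (Fin d) :=
  ∑ i, (ContinuousLinearMap.smulRightL ℝ _ _ (EuclideanSpace.proj i)) ∘L
    (tcoord p ((extChartAt (𝓡 d) p).symm a) ∘L
      (cov (fun q ↦ tvec p q (EuclideanSpace.basisFun (Fin d) ℝ i))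
        ((extChartAt (𝓡 d) p).symm a) ∘L tvec p ((extChartAt (𝓡 d) p).symm a)))

lemma christoffel_apply (cov : AffineConnection d N) {p q : N}
    (hq : q ∈ (extChartAt (𝓡 d) p).source) (v w : EuclideanSpace ℝ (Fin d)) :
    christoffel cov p (extChartAt (𝓡 d) p q) v w =
      ∑ i, w i • tcoord p q (cov (fun q ↦ tvec p q (EuclideanSpace.basisFun (Fin d) ℝ i)) q
        (tvec p q v)) := by
  simp only [christoffel]
  rw [(extChartAt (𝓡 d) p).left_inv hq]
  simp

lemma locField_smul (p : N) (g : N → ℝ) (W : Π q : N, TangentSpace (𝓡 d) q) :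
    locField p (g • W) = (g ∘ (extChartAt (𝓡 d) p).symm) • locField p W := by
  funext a
  exact (tcoord p _).map_smul _ _

lemma locField_add (p : N) (W W' : Π q : N, TangentSpace (𝓡 d) q) :
    locField p (W + W') = locField p W + locField p W' := by
  funext a
  exact (tcoord p _).map_add _ _

/-- The part of a connection which is not a derivative in the chart around `p`. -/
def covDefect (cov : AffineConnection d N) (p q : N) (u : TangentSpace (𝓡 d) q)
    (W : Π q : N, TangentSpace (𝓡 d) q) : EuclideanSpace ℝ (Fin d) :=
  tcoord p q (cov W q u) - fderiv ℝ (locField p W) (extChartAt (𝓡 d) p q) (tcoord p q u)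

/-- The connection and the coordinate derivative obey the Leibniz rule with the same derivative
term, which cancels in the difference. -/
lemma tensorialAt_covDefect (cov : AffineConnection d N) {p q : N}
    (hq : q ∈ (extChartAt (𝓡 d) p).source) (u : TangentSpace (𝓡 d) q) :
    TensorialAt (𝓡 d) (EuclideanSpace ℝ (Fin d)) (covDefect cov p q u) q where
  smul {g W} hg hW := by
    have h1 := (mdifferentiableAt_field_iff hq).1 hW
    have h2 := (mdifferentiableAt_iff_differentiableAt_comp_symm hq).1 hg
    simp only [covDefect]
    rw [cov.isCovariantDerivativeOnUniv.leibniz hW hg, locField_smul, fderiv_smul h2 h1,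
      locField_apply W hq]
    have := mvfderiv_eq_fderiv hq hg u
    simp [this, (extChartAt (𝓡 d) p).left_inv hq, smul_sub, -extChartAt]
  add {W W'} hW hW' := by
    have h1 := (mdifferentiableAt_field_iff hq).1 hW
    have h2 := (mdifferentiableAt_field_iff hq).1 hW'
    simp only [covDefect]
    rw [cov.isCovariantDerivativeOnUniv.add hW hW', locField_add, fderiv_add h1 h2]
    simp only [add_apply, map_add]
    abel

/-- The connection in the chart around `p`. -/
lemma tcoord_cov (cov : AffineConnection d N) {p q : N}
    (hq : q ∈ (extChartAt (𝓡 d) p).source) {W : Π q : N, TangentSpace (𝓡 d) q}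
    (hW : DifferentiableAt ℝ (locField p W) (extChartAt (𝓡 d) p q)) (u : TangentSpace (𝓡 d) q) :
    tcoord p q (cov W q u) = fderiv ℝ (locField p W) (extChartAt (𝓡 d) p q) (tcoord p q u)
      + christoffel cov p (extChartAt (𝓡 d) p q) (tcoord p q u) (tcoord p q (W q)) := by
  have hT := tensorialAt_covDefect cov hq u
  have hW' := (mdifferentiableAt_field_iff hq).2 hW
  have key : covDefect cov p q u W
      = christoffel cov p (extChartAt (𝓡 d) p q) (tcoord p q u) (tcoord p q (W q)) := by
    rw [← TensorialAt.mkHom_apply hT hW', christoffel_apply cov hq, tvec_tcoord hq]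
    -- By tensoriality the defect depends only on the value of `W` at `q`, so it suffices to expand
    -- that value in the coordinate frame, whose members have constant components.
    have hsum : W q = ∑ i, (tcoord p q (W q)) i •
        tvec p q (EuclideanSpace.basisFun (Fin d) ℝ i) := by
      rw [← tvec_tcoord hq (W q), tcoord_tvec hq]
      conv_lhs => rw [← (EuclideanSpace.basisFun (Fin d) ℝ).sum_repr (tcoord p q (W q))]
      simp
    conv_lhs => rw [hsum]
    rw [map_sum]
    refine Finset.sum_congr rfl fun i _ ↦ ?_
    rw [map_smul]
    congr 1
    rw [TensorialAt.mkHom_apply (σ := fun q ↦ tvec p q (EuclideanSpace.basisFun (Fin d) ℝ i)) hT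
      (mdifferentiableAt_tvec _ hq)]
    simp only [covDefect]
    rw [(locField_tvec_eventuallyEq _ ((extChartAt (𝓡 d) p).map_source hq)).fderiv_eq]
    simp
  rw [← key, covDefect]
  abel

lemma tcoord_cov_extendVec (cov : AffineConnection d N) {p q : N}
    (hq : q ∈ (extChartAt (𝓡 d) p).source) (w : TangentSpace (𝓡 d) p) (u : TangentSpace (𝓡 d) q) :
    tcoord p q (cov (extendVec w) q u)
      = christoffel cov p (extChartAt (𝓡 d) p q) (tcoord p q u) (tcoord p p w) := by
  have h := locField_extendVec_eventuallyEq w ((extChartAt (𝓡 d) p).map_source hq)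
  rw [tcoord_cov cov hq (differentiableAt_const _ |>.congr_of_eventuallyEq h), h.fderiv_eq,
    tcoord_extendVec w hq]
  simp

lemma tcoord_cov_tvec (cov : AffineConnection d N) {p q : N}
    (hq : q ∈ (extChartAt (𝓡 d) p).source) (w : EuclideanSpace ℝ (Fin d))
    (u : TangentSpace (𝓡 d) q) :
    tcoord p q (cov (fun q ↦ tvec p q w) q u)
      = christoffel cov p (extChartAt (𝓡 d) p q) (tcoord p q u) w := by
  have h := locField_tvec_eventuallyEq w ((extChartAt (𝓡 d) p).map_source hq)
  rw [tcoord_cov cov hq (differentiableAt_const _ |>.congr_of_eventuallyEq h), h.fderiv_eq,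
    tcoord_tvec hq]
  simp

/-- The constant vector field on a Euclidean space. -/
def constField (v : EuclideanSpace ℝ (Fin d)) (x : EuclideanSpace ℝ (Fin d)) :
    TangentSpace 𝓘(ℝ, EuclideanSpace ℝ (Fin d)) x := v

/-- Coordinate fields are pullbacks under the chart of constant fields, which commute, and the
bracket is natural under pullback. -/
lemma mlieBracket_tvec {p q : N} (hq : q ∈ (extChartAt (𝓡 d) p).source)
    (v w : EuclideanSpace ℝ (Fin d)) :
    VectorField.mlieBracket (𝓡 d) (fun q ↦ tvec (d := d) p q v) (fun q ↦ tvec p q w) q = 0 := by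
  have hev (v : EuclideanSpace ℝ (Fin d)) : (fun q ↦ tvec (d := d) p q v) =ᶠ[𝓝 q]
      VectorField.mpullback (𝓡 d) 𝓘(ℝ, EuclideanSpace ℝ (Fin d)) (extChartAt (𝓡 d) p)
        (constField v) := by
    filter_upwards [extChartAt_source_mem_nhds' hq] with y hy
    rw [VectorField.mpullback_apply]
    have h1 := isInvertible_mfderiv_extChartAt (I := 𝓡 d) hy
    refine (h1.inverse_apply_eq.2 ?_).symm
    rw [← tcoord_eq_mfderiv hy]
    exact (tcoord_tvec hy v).symm
  rw [Filter.EventuallyEq.mlieBracket_vectorField_eq (hev v) (hev w)]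
  have hd (v : EuclideanSpace ℝ (Fin d)) : MDifferentiableAt 𝓘(ℝ, EuclideanSpace ℝ (Fin d))
      (𝓘(ℝ, EuclideanSpace ℝ (Fin d)).prod 𝓘(ℝ, EuclideanSpace ℝ (Fin d)))
      (T% (constField v)) (extChartAt (𝓡 d) p q) :=
    ((contMDiffAt_vectorSpace_iff_contDiffAt (n := 1)).2 contDiffAt_const).mdifferentiableAt
      one_ne_zero
  have : IsManifold (𝓡 d) (minSmoothness ℝ 2) N := by simp; infer_instance
  rw [← VectorField.mpullback_mlieBracket (n := 2) (hd v) (hd w)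
    ((contMDiffAt_extChartAt' (I := 𝓡 d) (n := 2) (by simpa using hq))) (by simp)]
  have h0 (x : EuclideanSpace ℝ (Fin d)) : VectorField.mlieBracket
      𝓘(ℝ, EuclideanSpace ℝ (Fin d)) (constField v) (constField w) x = 0 := by
    rw [← VectorField.mlieBracketWithin_univ, VectorField.mlieBracketWithin_eq_lieBracketWithin]
    change fderivWithin ℝ (fun _ ↦ w) Set.univ x v - fderivWithin ℝ (fun _ ↦ v) Set.univ x w
      = (0 : EuclideanSpace ℝ (Fin d))
    simp
  rw [VectorField.mpullback_apply, h0, map_zero]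

/-- The covariant derivative of a field along a coordinate field, in the chart. -/
lemma locField_cov_eventuallyEq (cov : AffineConnection d N) {p : N}
    {W : Π q : N, TangentSpace (𝓡 d) q} {a : EuclideanSpace ℝ (Fin d)}
    (ha : a ∈ (extChartAt (𝓡 d) p).target)
    (hW : ContDiffAt ℝ ∞ (locField p W) a) (v : TangentSpace (𝓡 d) p) :
    locField p (fun q ↦ cov W q (extendVec v q)) =ᶠ[𝓝 a]
      locCov (christoffel cov p) (locField p W) (tcoord p p v) := by
  filter_upwards [(hW.of_le (m := 1) (by norm_cast)).eventually (by simp),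
    (isOpen_extChartAt_target p).mem_nhds ha] with b hb hbt
  have hq := (extChartAt (𝓡 d) p).map_target hbt
  have hr := (extChartAt (𝓡 d) p).right_inv hbt
  have hd := hb.differentiableAt one_ne_zero
  rw [← hr] at hd
  have h := tcoord_cov cov hq hd (extendVec v _)
  rw [tcoord_extendVec v hq, hr] at h
  exact h

/-- Near `p` the chosen extensions are coordinate fields, so the bracket term drops out. -/
lemma curvatureField_extendVec (cov : AffineConnection d N) {p : N}
    (W : Π q : N, TangentSpace (𝓡 d) q) (u v : TangentSpace (𝓡 d) p) :
    curvatureField cov (extendVec u) (extendVec v) W p =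
      cov (fun q ↦ cov W q (extendVec v q)) p u - cov (fun q ↦ cov W q (extendVec u q)) p v := by
  have hp := mem_extChartAt_source (I := 𝓡 d) p
  have he (u : TangentSpace (𝓡 d) p) : extendVec u =ᶠ[𝓝 p] fun q ↦ tvec p q (tcoord p p u) := by
    filter_upwards [extChartAt_source_mem_nhds' hp] with y hy
    exact extendVec_eq u hy
  rw [curvatureField, Filter.EventuallyEq.mlieBracket_vectorField_eq (he u) (he v),
    mlieBracket_tvec hp, map_zero, sub_zero, extendVec_self, extendVec_self]

lemma tcoord_curvatureField (cov : AffineConnection d N) {p : N}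
    (hΓ : DifferentiableAt ℝ (christoffel cov p) (extChartAt (𝓡 d) p p))
    {W : Π q : N, TangentSpace (𝓡 d) q}
    (hW : ContDiffAt ℝ ∞ (locField p W) (extChartAt (𝓡 d) p p)) (u v : TangentSpace (𝓡 d) p) :
    tcoord p p (curvatureField cov (extendVec u) (extendVec v) W p) =
      locCurv (christoffel cov p) (locField p W) (tcoord p p u) (tcoord p p v)
        (extChartAt (𝓡 d) p p) := by
  have hp := mem_extChartAt_source (I := 𝓡 d) p
  have ha := (extChartAt (𝓡 d) p).map_source hp
  have hW2 : ContDiffAt ℝ 2 (locField p W) (extChartAt (𝓡 d) p p) :=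
    hW.of_le (by norm_cast)
  have key (u v : TangentSpace (𝓡 d) p) :
      tcoord p p (cov (fun q ↦ cov W q (extendVec v q)) p u) =
      locCov (christoffel cov p) (locCov (christoffel cov p) (locField p W) (tcoord p p v))
        (tcoord p p u) (extChartAt (𝓡 d) p p) := by
    have he := locField_cov_eventuallyEq cov ha hW v
    rw [tcoord_cov cov hp ((hasFDerivAt_locCov hΓ hW2 _ 0).1.congr_of_eventuallyEq he),
      he.fderiv_eq, ← locField_apply (fun q ↦ cov W q (extendVec v q)) hp, he.eq_of_nhds]
    rfl
  rw [curvatureField_extendVec, map_sub, key, key, locCurv]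

lemma tcoord_curvature (cov : AffineConnection d N) {p : N}
    (hΓ : DifferentiableAt ℝ (christoffel cov p) (extChartAt (𝓡 d) p p))
    {W : Π q : N, TangentSpace (𝓡 d) q}
    (hW : ContDiffAt ℝ ∞ (locField p W) (extChartAt (𝓡 d) p p)) (u v : TangentSpace (𝓡 d) p) :
    tcoord p p (curvature cov p u v (W p)) =
      locCurv (christoffel cov p) (locField p W) (tcoord p p u) (tcoord p p v)
        (extChartAt (𝓡 d) p p) := by
  have hp := mem_extChartAt_source (I := 𝓡 d) p
  have hc := (contMDiffAt_field_iff hp).1 (contMDiffAt_extendVec (W p) hp)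
  rw [curvature, tcoord_curvatureField cov hΓ hc, locCurv_eq_const hΓ (hc.of_le
    (by norm_cast)), locCurv_eq_const hΓ (hW.of_le (by norm_cast)),
    locField_apply _ hp, locField_apply _ hp, extendVec_self]

/-- The curvature can be computed with any extension of its last argument. -/
lemma curvature_eq (cov : AffineConnection d N) {p : N}
    (hΓ : DifferentiableAt ℝ (christoffel cov p) (extChartAt (𝓡 d) p p))
    {W : Π q : N, TangentSpace (𝓡 d) q}
    (hW : ContDiffAt ℝ ∞ (locField p W) (extChartAt (𝓡 d) p p)) (u v : TangentSpace (𝓡 d) p) :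
    curvature cov p u v (W p) =
      cov (fun q ↦ cov W q (extendVec v q)) p u - cov (fun q ↦ cov W q (extendVec u q)) p v := by
  rw [← curvatureField_extendVec]
  refine tcoord_injective (mem_extChartAt_source p) ?_
  rw [tcoord_curvature cov hΓ hW, tcoord_curvatureField cov hΓ hW]

end Christoffel

/-! ### Smoothness from the Koszul formula. -/

section Koszul

variable {E : Type*} [NormedAddCommGroup E] [NormedSpace ℝ E] [FiniteDimensional ℝ E]

/-- An injective map to the dual space, as an equivalence. -/
lemma exists_equiv_of_nondegenerate (B : E →L[ℝ] E →L[ℝ] ℝ) (hB : ∀ v, B v = 0 → v = 0) :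
    ∃ e : E ≃L[ℝ] (E →L[ℝ] ℝ), (e : E →L[ℝ] E →L[ℝ] ℝ) = B := by
  have hd : Module.finrank ℝ E = Module.finrank ℝ (E →L[ℝ] ℝ) := by
    rw [← LinearEquiv.finrank_eq (LinearMap.toContinuousLinearMap (𝕜 := ℝ) (E := E) (F' := ℝ))]
    exact (Subspace.dual_finrank_eq (K := ℝ) (V := E)).symm
  have hinj : Function.Injective B.toLinearMap :=
    (injective_iff_map_eq_zero B.toLinearMap).2 hB
  refine ⟨(LinearMap.linearEquivOfInjective B.toLinearMap hinj hd).toContinuousLinearEquiv, ?_⟩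
  ext v w
  simp

/-- Christoffel symbols which satisfy the Koszul formula are smooth. -/
lemma contDiffOn_of_koszul {G : E → E →L[ℝ] E →L[ℝ] ℝ} {Γ : E → E →L[ℝ] E →L[ℝ] E} {Ω : Set E}
    (hΩ : IsOpen Ω) (hG : ContDiffOn ℝ ∞ G Ω) (hnd : ∀ a ∈ Ω, ∀ v, G a v = 0 → v = 0)
    (hΓ : ∀ a ∈ Ω, ∀ u v w, 2 * G a (Γ a u v) w =
      fderiv ℝ (fun b ↦ G b v w) a u + fderiv ℝ (fun b ↦ G b u w) a v
        - fderiv ℝ (fun b ↦ G b u v) a w) :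
    ContDiffOn ℝ ∞ Γ Ω := by
  have hG' (u v w : E) : ContDiffOn ℝ ∞ (fun a ↦ fderiv ℝ (fun b ↦ G b v w) a u) Ω :=
    (((hG.clm_apply contDiffOn_const).clm_apply contDiffOn_const).fderiv_of_isOpen
      (m := ∞) hΩ (by simp)).clm_apply contDiffOn_const
  rw [contDiffOn_clm_apply]
  intro u
  rw [contDiffOn_clm_apply]
  intro v
  -- The Koszul formula gives the Christoffel symbol with lowered index as a combination of
  -- derivatives of the metric.
  have hκ : ContDiffOn ℝ ∞ (fun a ↦ G a (Γ a u v)) Ω := by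
    rw [contDiffOn_clm_apply]
    intro w
    have h1 := (contDiffOn_const (c := (1 / 2 : ℝ))).mul (((hG' u v w).add (hG' v u w)).sub
      (hG' w u v))
    refine h1.congr fun a ha ↦ ?_
    rw [← hΓ a ha]
    ring
  intro a ha
  have haΩ := hΩ.mem_nhds ha
  obtain ⟨e, he⟩ := exists_equiv_of_nondegenerate (G a) (hnd a ha)
  -- The index is raised again with the inverse metric, inversion being smooth at invertible maps.
  have hinv : ContDiffAt ℝ ∞ (fun b ↦ (G b).inverse (G b (Γ b u v))) a := by
    refine ContDiffAt.clm_apply ?_ (hκ.contDiffAt haΩ)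
    refine ContDiffAt.comp a (g := ContinuousLinearMap.inverse) ?_ (hG.contDiffAt haΩ)
    rw [← he]
    exact contDiffAt_map_inverse e
  refine (hinv.congr_of_eventuallyEq ?_).contDiffWithinAt
  filter_upwards [haΩ] with b hb
  obtain ⟨e, he⟩ := exists_equiv_of_nondegenerate (G b) (hnd b hb)
  rw [← he, ContinuousLinearMap.inverse_equiv]
  simp

end Koszul

/-! ### The Levi-Civita connection in a chart. -/

section LeviCivita

variable {d : ℕ} {N : Type*} [TopologicalSpace N] [ChartedSpace (EuclideanSpace ℝ (Fin d)) N]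
  [IsManifold (𝓡 d) ∞ N]
  [RiemannianBundle (fun p : N ↦ TangentSpace (𝓡 d) p)]

/-- The metric in the chart around `p`. -/
def locMetric (p : N) (a : EuclideanSpace ℝ (Fin d)) :
    EuclideanSpace ℝ (Fin d) →L[ℝ] EuclideanSpace ℝ (Fin d) →L[ℝ] ℝ :=
  LinearMap.toContinuousBilinearMap (LinearMap.mk₂ ℝ
    (fun v w ↦ inner ℝ (tvec (d := d) p ((extChartAt (𝓡 d) p).symm a) v)
      (tvec p ((extChartAt (𝓡 d) p).symm a) w))
    (fun _ _ _ ↦ by rw [map_add, inner_add_left])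
    (fun _ _ _ ↦ by rw [map_smul, real_inner_smul_left]; rfl)
    (fun _ _ _ ↦ by rw [map_add, inner_add_right])
    (fun _ _ _ ↦ by rw [map_smul, real_inner_smul_right]; rfl))

lemma locMetric_apply (p : N) (a v w : EuclideanSpace ℝ (Fin d)) :
    locMetric p a v w = inner ℝ (tvec (d := d) p ((extChartAt (𝓡 d) p).symm a) v)
      (tvec p ((extChartAt (𝓡 d) p).symm a) w) := by
  simp [locMetric]

lemma locMetric_tcoord {p q : N} (hq : q ∈ (extChartAt (𝓡 d) p).source)
    (X Y : TangentSpace (𝓡 d) q) :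
    locMetric p (extChartAt (𝓡 d) p q) (tcoord p q X) (tcoord p q Y) = inner ℝ X Y := by
  rw [locMetric_apply, (extChartAt (𝓡 d) p).left_inv hq, tvec_tcoord hq, tvec_tcoord hq]

lemma locMetric_comm (p : N) (a v w : EuclideanSpace ℝ (Fin d)) :
    locMetric p a v w = locMetric p a w v := by
  rw [locMetric_apply, locMetric_apply, real_inner_comm]

lemma locMetric_self_eq_zero {p : N} {a : EuclideanSpace ℝ (Fin d)}
    (ha : a ∈ (extChartAt (𝓡 d) p).target) {v : EuclideanSpace ℝ (Fin d)}
    (h : locMetric p a v v = 0) : v = 0 := by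
  rw [locMetric_apply, inner_self_eq_zero] at h
  rw [← tcoord_tvec ((extChartAt (𝓡 d) p).map_target ha) v, h, map_zero]

variable [IsContMDiffRiemannianBundle (𝓡 d) ∞ (EuclideanSpace ℝ (Fin d))
    (fun p : N ↦ TangentSpace (𝓡 d) p)]

lemma isContMDiffRiemannianBundle_one : IsContMDiffRiemannianBundle (𝓡 d) 1
    (EuclideanSpace ℝ (Fin d)) (fun p : N ↦ TangentSpace (𝓡 d) p) :=
  IsContMDiffRiemannianBundle.of_le (n := ∞) (by exact_mod_cast le_top)

lemma contDiffOn_locMetric (p : N) :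
    ContDiffOn ℝ ∞ (locMetric (d := d) p) (extChartAt (𝓡 d) p).target := by
  rw [contDiffOn_clm_apply]
  intro v
  rw [contDiffOn_clm_apply]
  intro w a ha
  have hq := (extChartAt (𝓡 d) p).map_target ha
  have h := (contMDiffAt_iff_contDiffAt_comp_symm le_rfl hq).1
    ((contMDiffAt_tvec v hq).inner_bundle (contMDiffAt_tvec w hq))
  rw [(extChartAt (𝓡 d) p).right_inv ha] at h
  refine (h.congr_of_eventuallyEq (Eventually.of_forall fun b ↦ ?_)).contDiffWithinAt
  exact locMetric_apply p b v w

variable {cov : AffineConnection d N}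

lemma IsLeviCivita.mvfderiv_inner (hcov : IsLeviCivita cov) {q : N}
    {X Y : Π q : N, TangentSpace (𝓡 d) q}
    (hX : MDifferentiableAt (𝓡 d) ((𝓡 d).prod 𝓘(ℝ, EuclideanSpace ℝ (Fin d))) (T% X) q)
    (hY : MDifferentiableAt (𝓡 d) ((𝓡 d).prod 𝓘(ℝ, EuclideanSpace ℝ (Fin d))) (T% Y) q)
    (u : TangentSpace (𝓡 d) q) :
    mvfderiv (𝓡 d) (fun q ↦ (inner ℝ (X q) (Y q) : ℝ)) q u =
      inner ℝ (cov X q u) (Y q) + inner ℝ (X q) (cov Y q u) := by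
  have := isContMDiffRiemannianBundle_one (d := d) (N := N)
  have h := hcov.1.mvfderiv_inner_eq (extendVec u) hX hY
  simpa using h

lemma IsLeviCivita.fderiv_locMetric (hcov : IsLeviCivita cov) {p : N}
    {a : EuclideanSpace ℝ (Fin d)} (ha : a ∈ (extChartAt (𝓡 d) p).target)
    (u v w : EuclideanSpace ℝ (Fin d)) :
    fderiv ℝ (fun b ↦ locMetric p b v w) a u = locMetric p a (christoffel cov p a u v) w
      + locMetric p a v (christoffel cov p a u w) := by
  have hq := (extChartAt (𝓡 d) p).map_target ha
  have hr := (extChartAt (𝓡 d) p).right_inv ha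
  have := isContMDiffRiemannianBundle_one (d := d) (N := N)
  have h := hcov.mvfderiv_inner (mdifferentiableAt_tvec v hq) (mdifferentiableAt_tvec w hq)
    (tvec p _ u)
  rw [mvfderiv_eq_fderiv hq ((mdifferentiableAt_tvec v hq).inner_bundle
    (mdifferentiableAt_tvec w hq)), hr, tcoord_tvec hq] at h
  have h3 : (fun q ↦ (inner ℝ (tvec (d := d) p q v) (tvec p q w) : ℝ)) ∘
      (extChartAt (𝓡 d) p).symm = fun b ↦ locMetric p b v w := by
    funext b
    exact (locMetric_apply p b v w).symm
  rw [h3, ← locMetric_tcoord hq, ← locMetric_tcoord hq, tcoord_cov_tvec cov hq,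
    tcoord_cov_tvec cov hq, tcoord_tvec hq, tcoord_tvec hq, tcoord_tvec hq, hr] at h
  exact h

lemma IsLeviCivita.christoffel_comm (hcov : IsLeviCivita cov) {p : N}
    {a : EuclideanSpace ℝ (Fin d)} (ha : a ∈ (extChartAt (𝓡 d) p).target)
    (u v : EuclideanSpace ℝ (Fin d)) :
    christoffel cov p a u v = christoffel cov p a v u := by
  have hq := (extChartAt (𝓡 d) p).map_target ha
  have hr := (extChartAt (𝓡 d) p).right_inv ha
  have h := (CovariantDerivative.torsion_eq_zero_iff cov).1 hcov.2 (mdifferentiableAt_tvec u hq)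
    (mdifferentiableAt_tvec v hq)
  rw [mlieBracket_tvec hq, sub_eq_zero] at h
  have h2 := congrArg (tcoord p _) h
  rwa [tcoord_cov_tvec cov hq, tcoord_cov_tvec cov hq, tcoord_tvec hq, tcoord_tvec hq, hr] at h2

/-- `IsLeviCivita` imposes no regularity on the connection. Metric compatibility and symmetry of the
Christoffel symbols give the Koszul formula, which transfers the smoothness of the metric. -/
lemma IsLeviCivita.contDiffOn_christoffel (hcov : IsLeviCivita cov) (p : N) :
    ContDiffOn ℝ ∞ (christoffel cov p) (extChartAt (𝓡 d) p).target := by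
  refine contDiffOn_of_koszul (isOpen_extChartAt_target p) (contDiffOn_locMetric p)
    (fun a ha v hv ↦ locMetric_self_eq_zero ha (by rw [hv]; rfl)) fun a ha u v w ↦ ?_
  rw [hcov.fderiv_locMetric ha, hcov.fderiv_locMetric ha, hcov.fderiv_locMetric ha,
    hcov.christoffel_comm ha v u, hcov.christoffel_comm ha w u, hcov.christoffel_comm ha w v,
    locMetric_comm p a _ v, locMetric_comm p a u]
  ring

lemma IsLeviCivita.contDiffAt_christoffel (hcov : IsLeviCivita cov) {p : N}
    {a : EuclideanSpace ℝ (Fin d)} (ha : a ∈ (extChartAt (𝓡 d) p).target) :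
    ContDiffAt ℝ ∞ (christoffel cov p) a :=
  (hcov.contDiffOn_christoffel p).contDiffAt ((isOpen_extChartAt_target p).mem_nhds ha)

lemma IsLeviCivita.differentiableAt_christoffel (hcov : IsLeviCivita cov) (p : N) :
    DifferentiableAt ℝ (christoffel cov p) (extChartAt (𝓡 d) p p) :=
  (hcov.contDiffAt_christoffel (mem_extChartAt_target p)).differentiableAt (by simp)

end LeviCivita

/-! ### The second fundamental form of a map between vector spaces. -/

section LocalSecond

variable {E E' : Type*} [NormedAddCommGroup E] [NormedSpace ℝ E]
  [NormedAddCommGroup E'] [NormedSpace ℝ E']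

/-- The second fundamental form of a map `F` between vector spaces with Christoffel symbols
`Γ` and `Γ'`. -/
def locSecond (Γ' : E' → E' →L[ℝ] E' →L[ℝ] E') (Γ : E → E →L[ℝ] E →L[ℝ] E) (F : E → E')
    (v a : E) : E →L[ℝ] E' :=
  fderiv ℝ (fderiv ℝ F) a v + Γ' (F a) (fderiv ℝ F a v) ∘L fderiv ℝ F a - fderiv ℝ F a ∘L Γ a v

variable {Γ' : E' → E' →L[ℝ] E' →L[ℝ] E'} {Γ : E → E →L[ℝ] E →L[ℝ] E} {F : E → E'} {a : E}

lemma locSecond_apply (v w : E) : locSecond Γ' Γ F v a w = fderiv ℝ (fderiv ℝ F) a v w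
    + Γ' (F a) (fderiv ℝ F a v) (fderiv ℝ F a w) - fderiv ℝ F a (Γ a v w) := rfl

lemma locSecond_comm (hF : ContDiffAt ℝ 2 F a) (hΓ : ∀ u v, Γ a u v = Γ a v u)
    (hΓ' : ∀ u v, Γ' (F a) u v = Γ' (F a) v u) (u v : E) :
    locSecond Γ' Γ F u a v = locSecond Γ' Γ F v a u := by
  rw [locSecond_apply, locSecond_apply, (hF.isSymmSndFDerivAt (by simp)).eq u v, hΓ u v, hΓ']

lemma hasFDerivAt_fderiv_apply (hF : ContDiffAt ℝ 2 F a) (v : E) :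
    HasFDerivAt (fun b ↦ fderiv ℝ F b v) ((fderiv ℝ (fderiv ℝ F) a).flip v) a := by
  have h1 : HasFDerivAt (fderiv ℝ F) (fderiv ℝ (fderiv ℝ F) a) a :=
    ((hF.fderiv_right (m := 1) (by norm_num)).differentiableAt one_ne_zero).hasFDerivAt
  simpa using h1.clm_apply (hasFDerivAt_const v a)

lemma contDiffAt_locSecond (hF : ContDiffAt ℝ ∞ F a) (hΓ : ContDiffAt ℝ ∞ Γ a)
    (hΓ' : ContDiffAt ℝ ∞ Γ' (F a)) (v : E) : ContDiffAt ℝ ∞ (locSecond Γ' Γ F v) a := by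
  have h1 : ContDiffAt ℝ ∞ (fderiv ℝ F) a := hF.fderiv_right (by simp)
  have h2 : ContDiffAt ℝ ∞ (fderiv ℝ (fderiv ℝ F)) a := h1.fderiv_right (by simp)
  exact ((h2.clm_apply contDiffAt_const).add (((hΓ'.comp a hF).clm_apply
    (h1.clm_apply contDiffAt_const)).clm_comp h1)).sub (h1.clm_comp (hΓ.clm_apply contDiffAt_const))

set_option synthInstance.maxHeartbeats 200000 in
lemma fderiv_bilinear_comp {W : Type*} [NormedAddCommGroup W] [NormedSpace ℝ W]
    {B : E' → E' →L[ℝ] E' →L[ℝ] W} {X Y : E → E'} (hB : DifferentiableAt ℝ B (F a))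
    (hF : DifferentiableAt ℝ F a) (hX : DifferentiableAt ℝ X a) (hY : DifferentiableAt ℝ Y a)
    (u : E) : fderiv ℝ (fun b ↦ B (F b) (X b) (Y b)) a u =
      fderiv ℝ (fun b ↦ B b (X a) (Y a)) (F a) (fderiv ℝ F a u)
        + B (F a) (fderiv ℝ X a u) (Y a) + B (F a) (X a) (fderiv ℝ Y a u) := by
  have h0 : HasFDerivAt (fun b ↦ B (F b)) (fderiv ℝ B (F a) ∘L fderiv ℝ F a) a :=
    HasFDerivAt.comp (g := B) a hB.hasFDerivAt hF.hasFDerivAt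
  rw [((h0.clm_apply hX.hasFDerivAt).clm_apply hY.hasFDerivAt).fderiv,
    ((hB.hasFDerivAt.clm_apply (hasFDerivAt_const (X a) (F a))).clm_apply
      (hasFDerivAt_const (Y a) (F a))).fderiv]
  simp only [add_apply, ContinuousLinearMap.comp_apply, ContinuousLinearMap.flip_apply,
    ContinuousLinearMap.comp_zero, zero_add]
  abel

/-- The second fundamental form of an isometric map is normal. -/
lemma locSecond_orthogonal {G' : E' → E' →L[ℝ] E' →L[ℝ] ℝ} {G : E → E →L[ℝ] E →L[ℝ] ℝ}
    (hF : ContDiffAt ℝ 2 F a) (hG' : DifferentiableAt ℝ G' (F a))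
    (hΓ : ∀ u v, Γ a u v = Γ a v u) (hΓ' : ∀ u v, Γ' (F a) u v = Γ' (F a) v u)
    (hcomm : ∀ u v, G' (F a) u v = G' (F a) v u)
    (hiso : ∀ v w, (fun b ↦ G b v w) =ᶠ[𝓝 a] fun b ↦ G' (F b) (fderiv ℝ F b v) (fderiv ℝ F b w))
    (hc : ∀ u v w, fderiv ℝ (fun b ↦ G b v w) a u = G a (Γ a u v) w + G a v (Γ a u w))
    (hc' : ∀ u v w, fderiv ℝ (fun b ↦ G' b v w) (F a) u =
      G' (F a) (Γ' (F a) u v) w + G' (F a) v (Γ' (F a) u w)) (u v w : E) :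
    G' (F a) (locSecond Γ' Γ F u a v) (fderiv ℝ F a w) = 0 := by
  have hF1 := (hF.differentiableAt two_ne_zero).hasFDerivAt
  -- Differentiate the isometry identity in direction `u` and use metric compatibility on both
  -- sides.
  have hskew (u v w : E) : G' (F a) (locSecond Γ' Γ F u a v) (fderiv ℝ F a w) +
      G' (F a) (locSecond Γ' Γ F u a w) (fderiv ℝ F a v) = 0 := by
    have hd (v : E) := (hasFDerivAt_fderiv_apply hF v).differentiableAt
    have hd' (v u : E) : fderiv ℝ (fun b ↦ fderiv ℝ F b v) a u = fderiv ℝ (fderiv ℝ F) a u v := by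
      rw [(hasFDerivAt_fderiv_apply hF v).fderiv]
      rfl
    have h2 := hc u v w
    rw [(hiso v w).fderiv_eq, fderiv_bilinear_comp hG' hF1.differentiableAt (hd v) (hd w), hc',
      hd', hd'] at h2
    have h5 (x y : E) : G a x y = G' (F a) (fderiv ℝ F a x) (fderiv ℝ F a y) :=
      (hiso x y).eq_of_nhds
    simp only [h5] at h2
    simp only [locSecond_apply, map_sub, map_add, sub_apply, add_apply]
    rw [hcomm _ (fderiv ℝ F a v), hcomm _ (fderiv ℝ F a v), hcomm _ (fderiv ℝ F a v)]
    linarith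
  -- A trilinear expression symmetric in its first two arguments and skew in its last two vanishes,
  -- by the cyclic permutations below.
  have hs (u v : E) := locSecond_comm hF hΓ hΓ' u v
  have e1 := hskew u v w
  have e2 := hskew v w u
  have e3 := hskew w u v
  rw [hs v u] at e2
  rw [hs w v, hs w u] at e3
  linarith

end LocalSecond

/-! ### Fields along a map, in charts around `x` and `f x`. -/

section LocalSubmanifold

variable {d m : ℕ}
  {N : Type*} [TopologicalSpace N] [ChartedSpace (EuclideanSpace ℝ (Fin d)) N]
  {M : Type*} [TopologicalSpace M] [ChartedSpace (EuclideanSpace ℝ (Fin m)) M]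

/-- The map `f` in the charts around `x` and `f x`. -/
def locMap (f : M → N) (x : M) (a : EuclideanSpace ℝ (Fin m)) : EuclideanSpace ℝ (Fin d) :=
  extChartAt (𝓡 d) (f x) (f ((extChartAt (𝓡 m) x).symm a))

/-- The points where the charts around `x` and `f x` give coordinates for `f`. -/
def chartNhd (d m : ℕ) [ChartedSpace (EuclideanSpace ℝ (Fin d)) N]
    [ChartedSpace (EuclideanSpace ℝ (Fin m)) M] (f : M → N) (x : M) : Set M :=
  (extChartAt (𝓡 m) x).source ∩ f ⁻¹' (extChartAt (𝓡 d) (f x)).source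

variable {f : M → N} {x y : M}

lemma self_mem_chartNhd : x ∈ chartNhd d m f x :=
  ⟨mem_extChartAt_source x, mem_extChartAt_source (f x)⟩

lemma isOpen_chartNhd (hf : Continuous f) : IsOpen (chartNhd d m f x) :=
  (isOpen_extChartAt_source x).inter ((isOpen_extChartAt_source (f x)).preimage hf)

lemma eventually_chartNhd (hf : Continuous f) (hy : y ∈ chartNhd d m f x) :
    ∀ᶠ a in 𝓝 (extChartAt (𝓡 m) x y), a ∈ (extChartAt (𝓡 m) x).target ∧
      (extChartAt (𝓡 m) x).symm a ∈ chartNhd d m f x := by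
  have h1 := (isOpen_extChartAt_target (I := 𝓡 m) x).mem_nhds ((extChartAt (𝓡 m) x).map_source hy.1)
  have h2 := (continuousAt_extChartAt_symm' (I := 𝓡 m) hy.1)
  rw [ContinuousAt, (extChartAt (𝓡 m) x).left_inv hy.1] at h2
  filter_upwards [h1, h2 ((isOpen_chartNhd hf).mem_nhds hy)] with a ha hb using ⟨ha, hb⟩

lemma locMap_apply (hy : y ∈ chartNhd d m f x) :
    locMap f x (extChartAt (𝓡 m) x y) = extChartAt (𝓡 d) (f x) (f y) := by
  simp only [locMap]
  rw [(extChartAt (𝓡 m) x).left_inv hy.1]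

variable [IsManifold (𝓡 d) ∞ N]

/-- The component function, in the charts around `x` and `f x`, of a vector field along `f`. -/
def locAlong (f : M → N) (x : M) (V : Π y : M, TangentSpace (𝓡 d) (f y))
    (a : EuclideanSpace ℝ (Fin m)) : EuclideanSpace ℝ (Fin d) :=
  tcoord (f x) (f ((extChartAt (𝓡 m) x).symm a)) (V ((extChartAt (𝓡 m) x).symm a))

lemma locAlong_apply (V : Π y : M, TangentSpace (𝓡 d) (f y)) (hy : y ∈ chartNhd d m f x) :
    locAlong f x V (extChartAt (𝓡 m) x y) = tcoord (f x) (f y) (V y) := by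
  simp only [locAlong]
  rw [(extChartAt (𝓡 m) x).left_inv hy.1]

variable [IsManifold (𝓡 m) ∞ M]

lemma contDiffAt_locMap (hf : ContMDiff (𝓡 m) (𝓡 d) ∞ f) (hy : y ∈ chartNhd d m f x) :
    ContDiffAt ℝ ∞ (locMap (d := d) f x) (extChartAt (𝓡 m) x y) := by
  have h : ContMDiffAt (𝓡 m) 𝓘(ℝ, EuclideanSpace ℝ (Fin d)) ∞ (extChartAt (𝓡 d) (f x) ∘ f) y :=
    ContMDiffAt.comp y (contMDiffAt_extChartAt' (I := 𝓡 d) (by simpa using hy.2)) (hf y)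
  exact (contMDiffAt_iff_contDiffAt_comp_symm le_rfl hy.1).1 h

lemma tcoord_mfderiv (hf : ContMDiff (𝓡 m) (𝓡 d) ∞ f) (hy : y ∈ chartNhd d m f x)
    (u : TangentSpace (𝓡 m) y) : tcoord (f x) (f y) (mfderiv (𝓡 m) (𝓡 d) f y u) =
      fderiv ℝ (locMap f x) (extChartAt (𝓡 m) x y) (tcoord x y u) := by
  have h2 : MDifferentiableAt (𝓡 d) 𝓘(ℝ, EuclideanSpace ℝ (Fin d)) (extChartAt (𝓡 d) (f x))
    (f y) := mdifferentiableAt_extChartAt (by simpa using hy.2)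
  have h1 := hf.mdifferentiableAt (x := y) (by simp)
  have h3 := mvfderiv_eq_fderiv hy.1 (h2.comp y h1) u
  simp only [mvfderiv] at h3
  rw [mfderiv_comp y h2 h1] at h3
  rw [tcoord_eq_mfderiv hy.2]
  exact h3

lemma mdifferentiableAt_coordChange {p p' q : N} (hq : q ∈ (extChartAt (𝓡 d) p).source)
    (hq' : q ∈ (extChartAt (𝓡 d) p').source) :
    MDifferentiableAt (𝓡 d) 𝓘(ℝ, EuclideanSpace ℝ (Fin d) →L[ℝ] EuclideanSpace ℝ (Fin d))
      (fun r ↦ (tcoord p r ∘L tvec p' r :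
        EuclideanSpace ℝ (Fin d) →L[ℝ] EuclideanSpace ℝ (Fin d))) q := by
  have h := mdifferentiableAt_coordChangeL (𝕜 := ℝ) (IB := 𝓡 d)
    (e := trivializationAt (EuclideanSpace ℝ (Fin d)) (fun p : N ↦ TangentSpace (𝓡 d) p) p')
    (e' := trivializationAt (EuclideanSpace ℝ (Fin d)) (fun p : N ↦ TangentSpace (𝓡 d) p) p)
    (mem_baseSet_of_mem_source hq') (mem_baseSet_of_mem_source hq)
  refine h.congr_of_eventuallyEq ?_
  filter_upwards [extChartAt_source_mem_nhds' hq, extChartAt_source_mem_nhds' hq'] with r hr hr'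
  ext1 v
  have := Trivialization.coordChangeL_apply (R := ℝ)
    (trivializationAt (EuclideanSpace ℝ (Fin d)) (fun p : N ↦ TangentSpace (𝓡 d) p) p')
    (trivializationAt (EuclideanSpace ℝ (Fin d)) (fun p : N ↦ TangentSpace (𝓡 d) p) p)
    ⟨mem_baseSet_of_mem_source hr', mem_baseSet_of_mem_source hr⟩ v
  refine Eq.trans ?_ this.symm
  rw [trivializationAt_snd hr, tvec, ContinuousLinearMap.comp_apply,
    Trivialization.symmL_apply _ (mem_baseSet_of_mem_source hr')]

/-- `covAlong` uses at each `y` the trivialization around `f y`; to differentiate it further one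
needs a formula in one fixed chart. The derivative of the change of frame is exactly what the
connection contributes on the frame of the fixed chart, so the two choices agree. -/
lemma tcoord_covAlong (cov : AffineConnection d N) (hf : ContMDiff (𝓡 m) (𝓡 d) ∞ f)
    (hy : y ∈ chartNhd d m f x) {V : Π y : M, TangentSpace (𝓡 d) (f y)}
    (hV : DifferentiableAt ℝ (locAlong f x V) (extChartAt (𝓡 m) x y)) (u : TangentSpace (𝓡 m) y) :
    tcoord (f x) (f y) (covAlong cov f V y u) =
      fderiv ℝ (locAlong f x V) (extChartAt (𝓡 m) x y) (tcoord x y u)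
        + christoffel cov (f x) (extChartAt (𝓡 d) (f x) (f y))
          (fderiv ℝ (locMap f x) (extChartAt (𝓡 m) x y) (tcoord x y u))
          (tcoord (f x) (f y) (V y)) := by
  have hfy : MDifferentiableAt (𝓡 m) (𝓡 d) f y := hf.mdifferentiableAt (by simp)
  have hqq := mem_extChartAt_source (I := 𝓡 d) (f y)
  have hl := (extChartAt (𝓡 m) x).left_inv hy.1
  -- The change of frame from the chart around `f x` to the one around `f y`.
  set A : N → EuclideanSpace ℝ (Fin d) →L[ℝ] EuclideanSpace ℝ (Fin d) :=
    fun r ↦ tcoord (f y) r ∘L tvec (f x) r with hA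
  have hAd : MDifferentiableAt (𝓡 d) 𝓘(ℝ, EuclideanSpace ℝ (Fin d) →L[ℝ] EuclideanSpace ℝ (Fin d))
    A (f y) := mdifferentiableAt_coordChange hqq hy.2
  have hAfd := hAd.comp y hfy
  have hAf := (mdifferentiableAt_iff_differentiableAt_comp_symm hy.1).1 hAfd
  have hprod := hAf.hasFDerivAt.clm_apply hV.hasFDerivAt
  have hev : (fun z ↦ (trivializationAt (EuclideanSpace ℝ (Fin d))
      (fun p : N ↦ TangentSpace (𝓡 d) p) (f y) ⟨f z, V z⟩).2) ∘ (extChartAt (𝓡 m) x).symm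
      =ᶠ[𝓝 (extChartAt (𝓡 m) x y)] fun a ↦ ((A ∘ f) ∘ (extChartAt (𝓡 m) x).symm) a
        (locAlong f x V a) := by
    have h1 : ∀ᶠ a in 𝓝 (extChartAt (𝓡 m) x y),
        f ((extChartAt (𝓡 m) x).symm a) ∈ (extChartAt (𝓡 d) (f y)).source := by
      have h2 := (continuousAt_extChartAt_symm' (I := 𝓡 m) hy.1)
      rw [ContinuousAt, hl] at h2
      exact h2 (hf.continuous.continuousAt.preimage_mem_nhds (extChartAt_source_mem_nhds (f y)))
    filter_upwards [h1, eventually_chartNhd hf.continuous hy] with a ha hb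
    simp only [Function.comp_apply]
    rw [trivializationAt_snd ha, hA, locAlong, ContinuousLinearMap.comp_apply, tvec_tcoord hb.2.2]
  have hd := (mdifferentiableAt_iff_differentiableAt_comp_symm hy.1).2
    (hprod.differentiableAt.congr_of_eventuallyEq hev)
  have hmv := mvfderiv_eq_fderiv hy.1 hd u
  rw [hev.fderiv_eq, hprod.fderiv, add_apply, ContinuousLinearMap.comp_apply,
    ContinuousLinearMap.flip_apply, ← mvfderiv_eq_fderiv hy.1 hAfd u, locAlong_apply V hy] at hmv
  set w := tcoord (f x) (f y) (V y) with hw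
  set u' := mfderiv (𝓡 m) (𝓡 d) f y u with hu'
  have hVw : tvec (f x) (f y) w = V y := tvec_tcoord hy.2 _
  have hA0 := (mdifferentiableAt_iff_differentiableAt_comp_symm hqq).1 hAd
  have hWA := hA0.hasFDerivAt.clm_apply (hasFDerivAt_const w _)
  have hcov := tcoord_cov cov hqq (W := fun r ↦ tvec (f x) r w) hWA.differentiableAt u'
  have h3 : fderiv ℝ (locField (f y) fun r ↦ tvec (f x) r w) (extChartAt (𝓡 d) (f y) (f y))
      (tcoord (f y) (f y) u') = mvfderiv (𝓡 m) (A ∘ f) y u w := by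
    have h4 : mvfderiv (𝓡 m) (A ∘ f) y u = mvfderiv (𝓡 d) A (f y) u' := by
      simp only [mvfderiv]
      rw [mfderiv_comp y hAd hfy]
      rfl
    refine (congrArg (fun L ↦ L (tcoord (f y) (f y) u')) hWA.fderiv).trans ?_
    rw [h4, mvfderiv_eq_fderiv hqq hAd]
    simp
  rw [h3, hVw, ← tcoord_cov_extendVec cov hqq] at hcov
  have key : covAlong cov f V y u = tvec (f x) (f y) (fderiv ℝ (locAlong f x V)
      (extChartAt (𝓡 m) x y) (tcoord x y u)) + cov (fun r ↦ tvec (f x) r w) (f y) u' := by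
    refine tcoord_injective hqq ?_
    have h5 : covAlong cov f V y u = tvec (f y) (f y) (mvfderiv (𝓡 m) (fun z ↦
      (trivializationAt (EuclideanSpace ℝ (Fin d)) (fun p : N ↦ TangentSpace (𝓡 d) p) (f y)
        ⟨f z, V z⟩).2) y u) + cov (extendVec (V y)) (f y) u' := by
      rw [covAlong, tvec, Trivialization.symmL_apply _ (mem_baseSet_of_mem_source hqq)]
    rw [h5, map_add, map_add, hcov, tcoord_tvec hqq, hmv]
    simp only [Function.comp_apply]
    rw [hl, add_assoc]
    rfl
  rw [key, map_add, tcoord_tvec hy.2, tcoord_cov_tvec cov hy.2, hu', tcoord_mfderiv hf hy]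

/-- Used both when $\sigma$ vanishes identically and when only $\sigma(\cdot,\xi)$ does. -/
lemma covAlong_zero (covN : AffineConnection d N) (hf : ContMDiff (𝓡 m) (𝓡 d) ∞ f)
    (u : TangentSpace (𝓡 m) x) : covAlong covN f (fun _ ↦ 0) x u = 0 := by
  have hx : x ∈ chartNhd d m f x := self_mem_chartNhd
  have h0 : locAlong f x (fun y ↦ (0 : TangentSpace (𝓡 d) (f y))) =
      fun _ : EuclideanSpace ℝ (Fin m) ↦ 0 := by
    funext a
    exact map_zero _
  refine tcoord_injective hx.2 ?_
  rw [tcoord_covAlong covN hf hx (by rw [h0]; exact differentiableAt_const _), h0]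
  simp

end LocalSubmanifold

/-! ### Normal components. -/

section NormalPart

variable {d m : ℕ}
  {N : Type*} [TopologicalSpace N] [ChartedSpace (EuclideanSpace ℝ (Fin d)) N]
  {M : Type*} [TopologicalSpace M] [ChartedSpace (EuclideanSpace ℝ (Fin m)) M]
  [RiemannianBundle (fun p : N ↦ TangentSpace (𝓡 d) p)]
  {f : M → N} {x : M}

lemma inner_normalPart (w : TangentSpace (𝓡 d) (f x)) (t : TangentSpace (𝓡 m) x) :
    inner ℝ (normalPart (m := m) f x w) (mfderiv (𝓡 m) (𝓡 d) f x t) = 0 := by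
  rw [real_inner_comm]
  exact (Submodule.mem_orthogonal _ _).1 (Submodule.starProjection_apply_mem _ w) _
    (LinearMap.mem_range_self _ t)

lemma normalPart_add (w w' : TangentSpace (𝓡 d) (f x)) :
    normalPart (m := m) f x (w + w') = normalPart (m := m) f x w + normalPart (m := m) f x w' :=
  map_add _ _ _

lemma normalPart_zero : normalPart (m := m) f x (0 : TangentSpace (𝓡 d) (f x)) = 0 :=
  map_zero _

lemma normalPart_of_orthogonal {w : TangentSpace (𝓡 d) (f x)}
    (h : ∀ t : TangentSpace (𝓡 m) x, inner ℝ w (mfderiv (𝓡 m) (𝓡 d) f x t) = 0) :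
    normalPart (m := m) f x w = w := by
  refine Submodule.starProjection_eq_self_iff.2 ((Submodule.mem_orthogonal _ _).2 ?_)
  rintro _ ⟨t, rfl⟩
  rw [real_inner_comm]
  exact h t

lemma normalPart_mfderiv (t : TangentSpace (𝓡 m) x) :
    normalPart (m := m) f x (mfderiv (𝓡 m) (𝓡 d) f x t) = 0 := by
  refine (Submodule.starProjection_apply_eq_zero_iff _).2 ?_
  exact Submodule.le_orthogonal_orthogonal _ (LinearMap.mem_range_self _ t)

lemma eq_zero_of_normal_of_mem_range {w : TangentSpace (𝓡 d) (f x)}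
    (h : ∀ t : TangentSpace (𝓡 m) x, inner ℝ w (mfderiv (𝓡 m) (𝓡 d) f x t) = 0)
    (hw : w ∈ tangentRange (m := m) f x) : w = 0 := by
  obtain ⟨t, rfl⟩ := hw
  exact inner_self_eq_zero.1 (h t)

end NormalPart

section Isometric

variable {d m : ℕ}
  {N : Type*} [TopologicalSpace N] [ChartedSpace (EuclideanSpace ℝ (Fin d)) N]
  [RiemannianBundle (fun p : N ↦ TangentSpace (𝓡 d) p)]
  {M : Type*} [TopologicalSpace M] [ChartedSpace (EuclideanSpace ℝ (Fin m)) M]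
  [RiemannianBundle (fun x : M ↦ TangentSpace (𝓡 m) x)] {f : M → N}

lemma IsIsometricImmersion.injective_mfderiv (hf : IsIsometricImmersion (d := d) (m := m) f)
    (x : M) : Function.Injective (mfderiv (𝓡 m) (𝓡 d) f x) := by
  refine (injective_iff_map_eq_zero _).2 fun u hu ↦ ?_
  have h := hf.2 x u u
  rw [hu, inner_zero_left] at h
  exact inner_self_eq_zero.1 h.symm

end Isometric

/-! ### The Gauss formula, and the tensorial properties of $\sigma$ and $\widetilde\nabla\sigma$. -/

section SecondFundamentalForm

variable {d m : ℕ}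
  {N : Type*} [TopologicalSpace N] [ChartedSpace (EuclideanSpace ℝ (Fin d)) N]
  [IsManifold (𝓡 d) ∞ N]
  [RiemannianBundle (fun p : N ↦ TangentSpace (𝓡 d) p)]
  {M : Type*} [TopologicalSpace M] [ChartedSpace (EuclideanSpace ℝ (Fin m)) M]
  [IsManifold (𝓡 m) ∞ M] {covN : AffineConnection d N} {f : M → N} {x y : M}

lemma inner_secondFundamentalForm (u v t : TangentSpace (𝓡 m) x) :
    inner ℝ (secondFundamentalForm covN f x u v) (mfderiv (𝓡 m) (𝓡 d) f x t) = 0 :=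
  inner_normalPart _ t

/-- The second fundamental form of `f` in the charts around `x` and `f x`. -/
def chartSecond (covN : AffineConnection d N) (covM : AffineConnection m M) (f : M → N) (x : M)
    (v a : EuclideanSpace ℝ (Fin m)) : EuclideanSpace ℝ (Fin m) →L[ℝ] EuclideanSpace ℝ (Fin d) :=
  locSecond (christoffel covN (f x)) (christoffel covM x) (locMap f x) v a

variable {covM : AffineConnection m M}

lemma covDerivSecond_eq_zero (hf : ContMDiff (𝓡 m) (𝓡 d) ∞ f)
    (h : IsTotallyGeodesic (m := m) covN f) (u v w : TangentSpace (𝓡 m) x) :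
    covDerivSecond covN covM f x u v w = 0 := by
  have h' (y : M) (u v : TangentSpace (𝓡 m) y) : secondFundamentalForm covN f y u v = 0 := h y u v
  simp only [covDerivSecond, normalCov, h', covAlong_zero covN hf, normalPart_zero, sub_zero]

variable [RiemannianBundle (fun x : M ↦ TangentSpace (𝓡 m) x)]

lemma IsIsometricImmersion.locMetric_eq (hf : IsIsometricImmersion (d := d) (m := m) f)
    (hy : y ∈ chartNhd d m f x) (v w : EuclideanSpace ℝ (Fin m)) :
    locMetric x (extChartAt (𝓡 m) x y) v w =
      locMetric (f x) (locMap (d := d) f x (extChartAt (𝓡 m) x y))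
        (fderiv ℝ (locMap f x) (extChartAt (𝓡 m) x y) v)
        (fderiv ℝ (locMap f x) (extChartAt (𝓡 m) x y) w) := by
  have h (v : EuclideanSpace ℝ (Fin m)) := tcoord_mfderiv hf.1 hy (tvec x y v)
  simp only [tcoord_tvec hy.1] at h
  rw [← h, ← h, locMap_apply hy, locMetric_tcoord hy.2, hf.2]
  rw [locMetric_apply, (extChartAt (𝓡 m) x).left_inv hy.1]

/-- The Gauss formula, in charts. -/
lemma tcoord_covAlong_mfderiv (covN : AffineConnection d N) (covM : AffineConnection m M)
    (hf : IsIsometricImmersion (d := d) (m := m) f)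
    (hy : y ∈ chartNhd d m f x) {W : Π y : M, TangentSpace (𝓡 m) y}
    (hW : DifferentiableAt ℝ (locField x W) (extChartAt (𝓡 m) x y)) (u : TangentSpace (𝓡 m) y) :
    tcoord (f x) (f y) (covAlong covN f (fun z ↦ mfderiv (𝓡 m) (𝓡 d) f z (W z)) y u) =
      chartSecond covN covM f x (tcoord x y u) (extChartAt (𝓡 m) x y) (tcoord x y (W y))
        + tcoord (f x) (f y) (mfderiv (𝓡 m) (𝓡 d) f y (covM W y u)) := by
  have hF := contDiffAt_locMap hf.1 hy
  have hev : locAlong f x (fun z ↦ mfderiv (𝓡 m) (𝓡 d) f z (W z)) =ᶠ[𝓝 (extChartAt (𝓡 m) x y)]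
      fun a ↦ fderiv ℝ (locMap f x) a (locField x W a) := by
    filter_upwards [eventually_chartNhd hf.1.continuous hy] with a ha
    have h := tcoord_mfderiv hf.1 ha.2 (W ((extChartAt (𝓡 m) x).symm a))
    rwa [(extChartAt (𝓡 m) x).right_inv ha.1] at h
  have h1 : HasFDerivAt (fderiv ℝ (locMap f x)) (fderiv ℝ (fderiv ℝ (locMap (d := d) f x))
      (extChartAt (𝓡 m) x y)) (extChartAt (𝓡 m) x y) :=
    ((hF.fderiv_right (m := ∞) (by simp)).differentiableAt (by simp)).hasFDerivAt
  have h2 := h1.clm_apply hW.hasFDerivAt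
  rw [tcoord_covAlong covN hf.1 hy (h2.differentiableAt.congr_of_eventuallyEq hev), hev.fderiv_eq,
    h2.fderiv, tcoord_mfderiv hf.1 hy, tcoord_mfderiv hf.1 hy, tcoord_cov covM hy.1 hW,
    locField_apply W hy.1, chartSecond, locSecond_apply, locMap_apply hy]
  simp only [add_apply, ContinuousLinearMap.comp_apply, ContinuousLinearMap.flip_apply, map_add]
  abel

variable [IsContMDiffRiemannianBundle (𝓡 d) ∞ (EuclideanSpace ℝ (Fin d))
    (fun p : N ↦ TangentSpace (𝓡 d) p)]
  [IsContMDiffRiemannianBundle (𝓡 m) ∞ (EuclideanSpace ℝ (Fin m))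
    (fun p : M ↦ TangentSpace (𝓡 m) p)]

lemma locMetric_chartSecond (hcovN : IsLeviCivita covN) (hcovM : IsLeviCivita covM)
    (hf : IsIsometricImmersion (d := d) (m := m) f) (hy : y ∈ chartNhd d m f x)
    (u v w : EuclideanSpace ℝ (Fin m)) :
    locMetric (f x) (extChartAt (𝓡 d) (f x) (f y))
      (chartSecond covN covM f x u (extChartAt (𝓡 m) x y) v)
      (fderiv ℝ (locMap f x) (extChartAt (𝓡 m) x y) w) = 0 := by
  have ha := (extChartAt (𝓡 m) x).map_source hy.1
  have hb := (extChartAt (𝓡 d) (f x)).map_source hy.2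
  have hF := contDiffAt_locMap hf.1 hy
  rw [← locMap_apply hy] at hb ⊢
  refine locSecond_orthogonal (G := locMetric x) (hF.of_le (by norm_cast))
    (((contDiffOn_locMetric (f x)).contDiffAt
      ((isOpen_extChartAt_target (f x)).mem_nhds hb)).differentiableAt (by simp))
    (hcovM.christoffel_comm ha) (hcovN.christoffel_comm hb) (locMetric_comm _ _)
    (fun v w ↦ ?_) (hcovM.fderiv_locMetric ha) (hcovN.fderiv_locMetric hb) u v w
  filter_upwards [eventually_chartNhd hf.1.continuous hy] with a ha
  have h := hf.locMetric_eq ha.2 v w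
  rwa [(extChartAt (𝓡 m) x).right_inv ha.1] at h

/-- The chart expression is already normal by `locMetric_chartSecond`, so in the Gauss formula the
normal projection keeps it and kills the remaining tangent term. Symmetry, linearity and smoothness
of $\sigma$ are read off from this formula. -/
lemma tcoord_secondFundamentalForm (hcovN : IsLeviCivita covN) (hcovM : IsLeviCivita covM)
    (hf : IsIsometricImmersion (d := d) (m := m) f) (hy : y ∈ chartNhd d m f x)
    (u v : TangentSpace (𝓡 m) y) :
    tcoord (f x) (f y) (secondFundamentalForm covN f y u v) =
      chartSecond covN covM f x (tcoord x y u) (extChartAt (𝓡 m) x y) (tcoord x y v) := by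
  have hW : DifferentiableAt ℝ (locField x (extendVec v)) (extChartAt (𝓡 m) x y) :=
    ((contMDiffAt_field_iff hy.1).1
      (contMDiffAt_extendVec v (mem_extChartAt_source y))).differentiableAt (by simp)
  have h := tcoord_covAlong_mfderiv covN covM hf hy hW u
  rw [extendVec_self] at h
  set X := tvec (f x) (f y) (chartSecond covN covM f x (tcoord x y u) (extChartAt (𝓡 m) x y)
    (tcoord x y v)) with hX
  have hX' : tcoord (f x) (f y) X = chartSecond covN covM f x (tcoord x y u)
    (extChartAt (𝓡 m) x y) (tcoord x y v) := tcoord_tvec hy.2 _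
  rw [← hX', ← map_add] at h
  rw [secondFundamentalForm, tcoord_injective hy.2 h, normalPart_add, normalPart_mfderiv, add_zero,
    normalPart_of_orthogonal, hX']
  intro t
  rw [← locMetric_tcoord hy.2, hX', tcoord_mfderiv hf.1 hy]
  exact locMetric_chartSecond hcovN hcovM hf hy _ _ _

/-- The Gauss formula. -/
lemma covAlong_mfderiv (hcovN : IsLeviCivita covN) (hcovM : IsLeviCivita covM)
    (hf : IsIsometricImmersion (d := d) (m := m) f) {W : Π y : M, TangentSpace (𝓡 m) y}
    (hW : DifferentiableAt ℝ (locField x W) (extChartAt (𝓡 m) x x)) (u : TangentSpace (𝓡 m) x) :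
    covAlong covN f (fun z ↦ mfderiv (𝓡 m) (𝓡 d) f z (W z)) x u =
      secondFundamentalForm covN f x u (W x) + mfderiv (𝓡 m) (𝓡 d) f x (covM W x u) := by
  have hx : x ∈ chartNhd d m f x := self_mem_chartNhd
  refine tcoord_injective hx.2 ?_
  rw [map_add, tcoord_secondFundamentalForm hcovN hcovM hf hx,
    tcoord_covAlong_mfderiv covN covM hf hx hW]

lemma secondFundamentalForm_comm (hcovN : IsLeviCivita covN) (hcovM : IsLeviCivita covM)
    (hf : IsIsometricImmersion (d := d) (m := m) f) (u v : TangentSpace (𝓡 m) x) :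
    secondFundamentalForm covN f x u v = secondFundamentalForm covN f x v u := by
  have hx : x ∈ chartNhd d m f x := self_mem_chartNhd
  refine tcoord_injective hx.2 ?_
  rw [tcoord_secondFundamentalForm hcovN hcovM hf hx,
    tcoord_secondFundamentalForm hcovN hcovM hf hx]
  refine locSecond_comm ((contDiffAt_locMap hf.1 hx).of_le (by norm_cast))
    (hcovM.christoffel_comm ((extChartAt (𝓡 m) x).map_source hx.1)) (hcovN.christoffel_comm ?_) _ _
  rw [locMap_apply hx]
  exact (extChartAt (𝓡 d) (f x)).map_source hx.2

lemma secondFundamentalForm_add_right (hcovN : IsLeviCivita covN) (hcovM : IsLeviCivita covM)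
    (hf : IsIsometricImmersion (d := d) (m := m) f) (u v w : TangentSpace (𝓡 m) x) :
    secondFundamentalForm covN f x u (v + w) =
      secondFundamentalForm covN f x u v + secondFundamentalForm covN f x u w := by
  have hx : x ∈ chartNhd d m f x := self_mem_chartNhd
  refine tcoord_injective hx.2 ?_
  simp only [map_add, tcoord_secondFundamentalForm hcovN hcovM hf hx]

lemma secondFundamentalForm_smul_right (hcovN : IsLeviCivita covN) (hcovM : IsLeviCivita covM)
    (hf : IsIsometricImmersion (d := d) (m := m) f) (c : ℝ) (u v : TangentSpace (𝓡 m) x) :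
    secondFundamentalForm covN f x u (c • v) = c • secondFundamentalForm covN f x u v := by
  have hx : x ∈ chartNhd d m f x := self_mem_chartNhd
  refine tcoord_injective hx.2 ?_
  simp only [map_smul, tcoord_secondFundamentalForm hcovN hcovM hf hx]

/-- The chart expression of $\sigma$ on vectors with fixed components is continuous. -/
lemma eventually_exists_secondFundamentalForm_ne_zero (hcovN : IsLeviCivita covN)
    (hcovM : IsLeviCivita covM) (hf : IsIsometricImmersion (d := d) (m := m) f)
    {u v : TangentSpace (𝓡 m) x} (h : secondFundamentalForm covN f x u v ≠ 0) :
    ∀ᶠ y in 𝓝 x, ∃ u v : TangentSpace (𝓡 m) y, secondFundamentalForm covN f y u v ≠ 0 := by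
  have hx : x ∈ chartNhd d m f x := self_mem_chartNhd
  have h1 : chartSecond covN covM f x (tcoord x x u) (extChartAt (𝓡 m) x x) (tcoord x x v) ≠ 0 := by
    rw [← tcoord_secondFundamentalForm hcovN hcovM hf hx]
    exact fun h0 ↦ h (tcoord_injective hx.2 (by rw [h0, map_zero]))
  have hc := (contDiffAt_locSecond (contDiffAt_locMap hf.1 hx)
    (hcovM.contDiffAt_christoffel (mem_extChartAt_target x))
    (hcovN.contDiffAt_christoffel (a := locMap f x (extChartAt (𝓡 m) x x)) (by
      rw [locMap_apply hx]; exact (extChartAt (𝓡 d) (f x)).map_source hx.2))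
    (tcoord x x u)).continuousAt.clm_apply (continuousAt_const (y := tcoord x x v))
  have h2 := (hc.comp (continuousAt_extChartAt (I := 𝓡 m) x)).eventually_ne h1
  filter_upwards [h2, (isOpen_chartNhd hf.1.continuous).mem_nhds hx] with y hy hy'
  refine ⟨tvec x y (tcoord x x u), tvec x y (tcoord x x v), fun h0 ↦ hy ?_⟩
  have h3 := tcoord_secondFundamentalForm hcovN hcovM hf hy' (tvec x y (tcoord x x u))
    (tvec x y (tcoord x x v))
  rw [h0, map_zero, tcoord_tvec hy'.1, tcoord_tvec hy'.1] at h3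
  exact h3.symm

lemma covDerivSecond_comm (hcovN : IsLeviCivita covN) (hcovM : IsLeviCivita covM)
    (hf : IsIsometricImmersion (d := d) (m := m) f) (u v w : TangentSpace (𝓡 m) x) :
    covDerivSecond covN covM f x u v w = covDerivSecond covN covM f x u w v := by
  have hc (y : M) (u v : TangentSpace (𝓡 m) y) := secondFundamentalForm_comm hcovN hcovM hf u v
  simp only [covDerivSecond]
  rw [funext fun y ↦ hc y (extendVec v y) (extendVec w y), hc x v, hc x _ w]
  abel

/-- The covariant derivative of the second fundamental form can be computed with any extension of
its last argument. -/
lemma covDerivSecond_eq (hcovN : IsLeviCivita covN) (hcovM : IsLeviCivita covM)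
    (hf : IsIsometricImmersion (d := d) (m := m) f) {W : Π y : M, TangentSpace (𝓡 m) y}
    (hW : DifferentiableAt ℝ (locField x W) (extChartAt (𝓡 m) x x)) (u v : TangentSpace (𝓡 m) x) :
    covDerivSecond covN covM f x u v (W x) =
      normalCov covN f (fun y ↦ secondFundamentalForm covN f y (extendVec v y) (W y)) x u
        - secondFundamentalForm covN f x (covM (extendVec v) x u) (W x)
        - secondFundamentalForm covN f x v (covM W x u) := by
  have hx : x ∈ chartNhd d m f x := self_mem_chartNhd
  have hs : DifferentiableAt ℝ (chartSecond covN covM f x (tcoord x x v)) (extChartAt (𝓡 m) x x) :=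
    (contDiffAt_locSecond (contDiffAt_locMap hf.1 hx)
      (hcovM.contDiffAt_christoffel (mem_extChartAt_target x))
      (hcovN.contDiffAt_christoffel (a := locMap f x (extChartAt (𝓡 m) x x)) (by
        rw [locMap_apply hx]; exact (extChartAt (𝓡 d) (f x)).map_source hx.2))
      (tcoord x x v)).differentiableAt (by simp)
  -- Only the last summand involves more of `W` than its value at `x`, and the term
  -- $-\sigma(v,\nabla_uW)$ in the definition of $\widetilde\nabla\sigma$ removes it.
  have key {W : Π y : M, TangentSpace (𝓡 m) y}
      (hW : DifferentiableAt ℝ (locField x W) (extChartAt (𝓡 m) x x)) :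
      covAlong covN f (fun y ↦ secondFundamentalForm covN f y (extendVec v y) (W y)) x u =
        tvec (f x) (f x) (fderiv ℝ (chartSecond covN covM f x (tcoord x x v))
            (extChartAt (𝓡 m) x x) (tcoord x x u) (tcoord x x (W x))
          + christoffel covN (f x) (extChartAt (𝓡 d) (f x) (f x))
          (fderiv ℝ (locMap f x) (extChartAt (𝓡 m) x x) (tcoord x x u))
          (tcoord (f x) (f x) (secondFundamentalForm covN f x v (W x)))
          - tcoord (f x) (f x) (secondFundamentalForm covN f x v (covM (extendVec (W x)) x u)))
        + secondFundamentalForm covN f x v (covM W x u) := by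
    have hev : locAlong f x (fun y ↦ secondFundamentalForm covN f y (extendVec v y) (W y))
        =ᶠ[𝓝 (extChartAt (𝓡 m) x x)]
        fun a ↦ chartSecond covN covM f x (tcoord x x v) a (locField x W a) := by
      filter_upwards [eventually_chartNhd hf.1.continuous hx] with a ha
      have h := tcoord_secondFundamentalForm hcovN hcovM hf ha.2 (extendVec v _)
        (W ((extChartAt (𝓡 m) x).symm a))
      rwa [(extChartAt (𝓡 m) x).right_inv ha.1, tcoord_extendVec v ha.2.1] at h
    have h2 := hs.hasFDerivAt.clm_apply hW.hasFDerivAt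
    refine tcoord_injective hx.2 ?_
    rw [tcoord_covAlong covN hf.1 hx (h2.differentiableAt.congr_of_eventuallyEq hev),
      hev.fderiv_eq, h2.fderiv, map_add, tcoord_tvec hx.2,
      tcoord_secondFundamentalForm hcovN hcovM hf hx v (covM W x u),
      tcoord_secondFundamentalForm hcovN hcovM hf hx v (covM (extendVec (W x)) x u),
      tcoord_cov covM hx.1 hW, tcoord_cov_extendVec covM hx.1, locField_apply W hx.1,
      extendVec_self]
    simp only [add_apply, ContinuousLinearMap.comp_apply, ContinuousLinearMap.flip_apply, map_add]
    abel
  have hE : DifferentiableAt ℝ (locField x (extendVec (W x))) (extChartAt (𝓡 m) x x) :=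
    ((contMDiffAt_field_iff hx.1).1 (contMDiffAt_extendVec _ hx.1)).differentiableAt (by simp)
  have hn (v w : TangentSpace (𝓡 m) x) :
      normalPart (m := m) f x (secondFundamentalForm covN f x v w) =
        secondFundamentalForm covN f x v w :=
    normalPart_of_orthogonal (inner_secondFundamentalForm v w)
  rw [covDerivSecond, normalCov, normalCov, key hW, key hE, normalPart_add, normalPart_add, hn, hn,
    extendVec_self]
  abel

end SecondFundamentalForm

/-! ### The characteristic field of the ambient structure. -/

namespace AlmostContactMetricStructure

variable {d : ℕ} {N : Type*} [TopologicalSpace N] [ChartedSpace (EuclideanSpace ℝ (Fin d)) N]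
  [IsManifold (𝓡 d) ∞ N]
  [RiemannianBundle (fun p : N ↦ TangentSpace (𝓡 d) p)]
  {A : AlmostContactMetricStructure d N} {cov : AffineConnection d N}

/-- The Leibniz terms cancel because $\phi$ is linear over functions. This allows $\xi$ itself to
serve as the extension of its value in $(\widetilde\nabla_v\phi)\xi$. -/
lemma tensorialAt_covDerivEndo (A : AlmostContactMetricStructure d N) (cov : AffineConnection d N)
    (p : N) (v : TangentSpace (𝓡 d) p) :
    TensorialAt (𝓡 d) (EuclideanSpace ℝ (Fin d)) (fun W : Π q : N, TangentSpace (𝓡 d) q ↦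
      cov (fun q ↦ A.φ q (W q)) p v - A.φ p (cov W p v)) p where
  smul {g W} hg hW := by
    have hφ := (A.smooth_φ.mdifferentiable (by simp) p).clm_bundle_apply hW
    have h1 := cov.isCovariantDerivativeOnUniv.leibniz hφ hg
    have h2 : (fun q ↦ A.φ q ((g • W) q)) = g • fun q ↦ A.φ q (W q) := by
      funext q
      exact (A.φ q).map_smul _ _
    rw [h2, h1, cov.isCovariantDerivativeOnUniv.leibniz hW hg]
    simp [smul_sub]
  add {W W'} hW hW' := by
    have hφ := (A.smooth_φ.mdifferentiable (by simp) p).clm_bundle_apply hW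
    have hφ' := (A.smooth_φ.mdifferentiable (by simp) p).clm_bundle_apply hW'
    have h2 : (fun q ↦ A.φ q ((W + W') q)) = (fun q ↦ A.φ q (W q)) + fun q ↦ A.φ q (W' q) := by
      funext q
      exact (A.φ q).map_add _ _
    rw [h2, cov.isCovariantDerivativeOnUniv.add hφ hφ', cov.isCovariantDerivativeOnUniv.add hW hW']
    simp only [add_apply, map_add]
    abel

lemma covDerivEndo_ξ (A : AlmostContactMetricStructure d N) (cov : AffineConnection d N) (p : N)
    (v : TangentSpace (𝓡 d) p) : covDerivEndo cov A.φ p v (A.ξ p) = - A.φ p (cov A.ξ p v) := by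
  have hp := mem_extChartAt_source (I := 𝓡 d) p
  have h := (A.tensorialAt_covDerivEndo cov p v).pointwise
    ((contMDiffAt_extendVec (A.ξ p) hp).mdifferentiableAt (by simp))
    (A.smooth_ξ.mdifferentiable (by simp) p) (extendVec_self _)
  have h0 : (fun q ↦ A.φ q (A.ξ q)) = 0 := funext A.φ_ξ
  simp only [h0, cov.zero] at h
  rw [covDerivEndo, h]
  simp

lemma inner_ξ_ξ (A : AlmostContactMetricStructure d N) (p : N) :
    (inner ℝ (A.ξ p) (A.ξ p) : ℝ) = 1 := by
  rw [← A.η_eq, A.η_ξ]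

lemma curvature_ξ (A : AlmostContactMetricStructure d N) {f₁ f₂ f₃ : N → ℝ}
    (hA : A.IsGeneralizedSasakianSpaceForm cov f₁ f₂ f₃) {p : N} (X Y : TangentSpace (𝓡 d) p) :
    curvature cov p X Y (A.ξ p) = (f₁ p - f₃ p) • (A.η p Y • X - A.η p X • Y) := by
  rw [hA.curvature_eq, A.φ_ξ, inner_zero_right, inner_zero_right, ← A.η_eq, ← A.η_eq, A.η_ξ]
  simp only [zero_smul, smul_zero, mul_one]
  rw [mul_comm (A.η p Y)]
  module

lemma contDiffAt_locField_ξ (A : AlmostContactMetricStructure d N)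
    (p : N) : ContDiffAt ℝ ∞ (locField p A.ξ) (extChartAt (𝓡 d) p p) :=
  (contMDiffAt_field_iff (mem_extChartAt_source p)).1 (A.smooth_ξ p)

variable [IsContMDiffRiemannianBundle (𝓡 d) ∞ (EuclideanSpace ℝ (Fin d))
    (fun p : N ↦ TangentSpace (𝓡 d) p)]

/-- Differentiate $g(\xi,\xi)=1$. -/
lemma η_cov_ξ (A : AlmostContactMetricStructure d N) (hcov : IsLeviCivita cov) (p : N)
    (v : TangentSpace (𝓡 d) p) : A.η p (cov A.ξ p v) = 0 := by
  have hξ := A.smooth_ξ.mdifferentiable (by simp) p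
  have h := hcov.mvfderiv_inner hξ hξ v
  have h0 : mvfderiv (𝓡 d) (fun q ↦ (inner ℝ (A.ξ q) (A.ξ q) : ℝ)) p v = 0 := by
    rw [funext A.inner_ξ_ξ]
    simp [mvfderiv]
  rw [h0, real_inner_comm, ← two_mul] at h
  rw [A.η_eq, real_inner_comm]
  linarith

/-- The covariant derivative of the characteristic vector field of a trans-Sasakian structure. -/
lemma cov_ξ (A : AlmostContactMetricStructure d N) (hcov : IsLeviCivita cov) {p : N} {α β : ℝ}
    (h : ∀ X Y : TangentSpace (𝓡 d) p, covDerivEndo cov A.φ p X Y =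
      α • (inner ℝ X Y • A.ξ p - A.η p Y • X)
      + β • (inner ℝ (A.φ p X) Y • A.ξ p - A.η p Y • A.φ p X))
    (v : TangentSpace (𝓡 d) p) :
    cov A.ξ p v = β • (v - A.η p v • A.ξ p) - α • A.φ p v := by
  have h1 := h v (A.ξ p)
  rw [A.covDerivEndo_ξ, ← A.η_eq, ← A.η_eq, A.η_ξ, A.η_φ] at h1
  -- Since $\phi^2=-1$ on the kernel of $\eta$, where $\widetilde\nabla_v\xi$ lies by `η_cov_ξ`,
  -- applying $\phi$ solves for $\widetilde\nabla_v\xi$.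
  have h2 := congrArg (A.φ p) h1
  simp only [map_neg, map_add, map_sub, map_smul, A.φ_φ, A.φ_ξ, A.η_cov_ξ hcov] at h2
  simp only [zero_smul, add_zero, neg_neg, smul_zero, one_smul, zero_sub] at h2
  rw [h2]
  module

end AlmostContactMetricStructure

/-! ### Differentiating a connection along a map. -/

section LocalPullback

variable {E E' : Type*} [NormedAddCommGroup E] [NormedSpace ℝ E]
  [NormedAddCommGroup E'] [NormedSpace ℝ E']

-- Chain rule, arranged so that the second derivative of `F` stands alone: it is symmetric in `u`
-- and `v` and cancels when the two orders of differentiation are subtracted.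
set_option synthInstance.maxHeartbeats 200000 in
lemma hasFDerivAt_locCov_comp {Γ' : E' → E' →L[ℝ] E' →L[ℝ] E'} {F : E → E'} {X : E' → E'} {a : E}
    (hF : ContDiffAt ℝ 2 F a) (hΓ' : DifferentiableAt ℝ Γ' (F a)) (hX : ContDiffAt ℝ 2 X (F a))
    (v u : E) :
    DifferentiableAt ℝ (fun b ↦ locCov Γ' X (fderiv ℝ F b v) (F b)) a ∧
      fderiv ℝ (fun b ↦ locCov Γ' X (fderiv ℝ F b v) (F b)) a u =
        fderiv ℝ (locCov Γ' X (fderiv ℝ F a v)) (F a) (fderiv ℝ F a u)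
          + locCov Γ' X (fderiv ℝ (fderiv ℝ F) a u v) (F a) := by
  have hF1 := (hF.differentiableAt two_ne_zero).hasFDerivAt
  have hFv := hasFDerivAt_fderiv_apply hF v
  have h1 : HasFDerivAt (fderiv ℝ X) (fderiv ℝ (fderiv ℝ X) (F a)) (F a) :=
    ((hX.fderiv_right (m := 1) (by norm_num)).differentiableAt one_ne_zero).hasFDerivAt
  have h2 := (hX.differentiableAt two_ne_zero).hasFDerivAt
  have h3 := HasFDerivAt.clm_apply (HasFDerivAt.comp (g := fderiv ℝ X) a h1 hF1) hFv
  have h4 := HasFDerivAt.clm_apply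
    (HasFDerivAt.clm_apply (HasFDerivAt.comp (g := Γ') a hΓ'.hasFDerivAt hF1) hFv)
    (HasFDerivAt.comp (g := X) a h2 hF1)
  have h5 := h3.add h4
  refine ⟨h5.differentiableAt, (congrArg (fun L ↦ L u) h5.fderiv).trans ?_⟩
  rw [(hasFDerivAt_locCov hΓ' hX _ _).2, locCov]
  simp only [add_apply, ContinuousLinearMap.comp_apply, ContinuousLinearMap.flip_apply,
    Function.comp_apply]
  abel

end LocalPullback

/-! ### Pulling back fields and curvature to a submanifold. -/

section Pullback

variable {d m : ℕ}
  {N : Type*} [TopologicalSpace N] [ChartedSpace (EuclideanSpace ℝ (Fin d)) N]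
  [IsManifold (𝓡 d) ∞ N]
  {M : Type*} [TopologicalSpace M] [ChartedSpace (EuclideanSpace ℝ (Fin m)) M]
  [IsManifold (𝓡 m) ∞ M]
  {f : M → N} {x : M}

/-- The covariant derivative along `f` of the restriction of a vector field. -/
lemma covAlong_comp (cov : AffineConnection d N) (hf : ContMDiff (𝓡 m) (𝓡 d) ∞ f)
    {V : Π p : N, TangentSpace (𝓡 d) p}
    (hV : DifferentiableAt ℝ (locField (f x) V) (extChartAt (𝓡 d) (f x) (f x)))
    (u : TangentSpace (𝓡 m) x) :
    covAlong cov f (fun y ↦ V (f y)) x u = cov V (f x) (mfderiv (𝓡 m) (𝓡 d) f x u) := by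
  have hx : x ∈ chartNhd d m f x := self_mem_chartNhd
  have hev : locAlong f x (fun y ↦ V (f y)) =ᶠ[𝓝 (extChartAt (𝓡 m) x x)]
      locField (f x) V ∘ locMap f x := by
    filter_upwards [eventually_chartNhd hf.continuous hx] with a ha
    exact (locField_apply V ha.2.2).symm
  have hF := (contDiffAt_locMap hf hx).differentiableAt (by simp)
  have hV' := hV
  rw [← locMap_apply hx] at hV
  refine tcoord_injective hx.2 ?_
  rw [tcoord_covAlong cov hf hx ((hV.comp _ hF).congr_of_eventuallyEq hev), hev.fderiv_eq,
    fderiv_comp _ hV hF, tcoord_cov cov hx.2 hV', tcoord_mfderiv hf hx, locMap_apply hx]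
  rfl

/-- The curvature of the pulled-back connection is the pull-back of the curvature. -/
lemma covAlong_cov_sub (cov : AffineConnection d N) (hf : ContMDiff (𝓡 m) (𝓡 d) ∞ f)
    (hΓ : DifferentiableAt ℝ (christoffel cov (f x)) (extChartAt (𝓡 d) (f x) (f x)))
    {V : Π p : N, TangentSpace (𝓡 d) p}
    (hV : ContDiffAt ℝ ∞ (locField (f x) V) (extChartAt (𝓡 d) (f x) (f x)))
    (u v : TangentSpace (𝓡 m) x) :
    covAlong cov f (fun y ↦ cov V (f y) (mfderiv (𝓡 m) (𝓡 d) f y (extendVec v y))) x u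
      - covAlong cov f (fun y ↦ cov V (f y) (mfderiv (𝓡 m) (𝓡 d) f y (extendVec u y))) x v =
    curvature cov (f x) (mfderiv (𝓡 m) (𝓡 d) f x u) (mfderiv (𝓡 m) (𝓡 d) f x v) (V (f x)) := by
  have hx : x ∈ chartNhd d m f x := self_mem_chartNhd
  have hF : ContDiffAt ℝ 2 (locMap (d := d) f x) (extChartAt (𝓡 m) x x) :=
    (contDiffAt_locMap hf hx).of_le (by norm_cast)
  have hF0 := locMap_apply hx
  have hΓ' := hΓ
  have hV' := hV
  rw [← hF0] at hΓ' hV'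
  have hVe : ∀ᶠ a in 𝓝 (extChartAt (𝓡 m) x x),
      DifferentiableAt ℝ (locField (f x) V) (locMap f x a) := by
    have h := (hV'.of_le (m := 1) (by norm_cast)).eventually (by simp)
    filter_upwards [(contDiffAt_locMap hf hx).continuousAt.eventually h] with a ha
    exact ha.differentiableAt one_ne_zero
  have key (u v : TangentSpace (𝓡 m) x) : tcoord (f x) (f x) (covAlong cov f (fun y ↦
      cov V (f y) (mfderiv (𝓡 m) (𝓡 d) f y (extendVec v y))) x u) =
      locCov (christoffel cov (f x)) (locCov (christoffel cov (f x)) (locField (f x) V)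
          (fderiv ℝ (locMap f x) (extChartAt (𝓡 m) x x) (tcoord x x v)))
        (fderiv ℝ (locMap f x) (extChartAt (𝓡 m) x x) (tcoord x x u))
        (locMap f x (extChartAt (𝓡 m) x x))
      + locCov (christoffel cov (f x)) (locField (f x) V)
        (fderiv ℝ (fderiv ℝ (locMap f x)) (extChartAt (𝓡 m) x x) (tcoord x x u) (tcoord x x v))
        (locMap f x (extChartAt (𝓡 m) x x)) := by
    have hev : locAlong f x (fun y ↦ cov V (f y) (mfderiv (𝓡 m) (𝓡 d) f y (extendVec v y)))
        =ᶠ[𝓝 (extChartAt (𝓡 m) x x)] fun a ↦ locCov (christoffel cov (f x)) (locField (f x) V)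
          (fderiv ℝ (locMap f x) a (tcoord x x v)) (locMap f x a) := by
      filter_upwards [eventually_chartNhd hf.continuous hx, hVe] with a ha hVa
      have hl := locMap_apply ha.2
      have hr := (extChartAt (𝓡 m) x).right_inv ha.1
      rw [hr] at hl
      rw [hl] at hVa
      have h := tcoord_cov cov ha.2.2 hVa (mfderiv (𝓡 m) (𝓡 d) f _ (extendVec v _))
      rw [tcoord_mfderiv hf ha.2, tcoord_extendVec v ha.2.1, hr, ← locField_apply V ha.2.2,
        ← hl] at h
      exact h
    have h := hasFDerivAt_locCov_comp hF hΓ' (hV'.of_le (by norm_cast)) (tcoord x x v)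
      (tcoord x x u)
    have h0 := (locAlong_apply _ hx).symm.trans hev.eq_of_nhds
    rw [tcoord_covAlong cov hf hx (h.1.congr_of_eventuallyEq hev), hev.fderiv_eq, h.2, h0, ← hF0]
    simp only [locCov]
    abel
  refine tcoord_injective hx.2 ?_
  rw [map_sub, key, key, tcoord_curvature cov hΓ hV, tcoord_mfderiv hf hx, tcoord_mfderiv hf hx,
    (hF.isSymmSndFDerivAt (by simp)).eq (tcoord x x u), locCurv, hF0]
  abel

variable [RiemannianBundle (fun p : N ↦ TangentSpace (𝓡 d) p)]
  [RiemannianBundle (fun x : M ↦ TangentSpace (𝓡 m) x)]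

/-- A vector field which is tangent to a submanifold restricts to a smooth field. -/
lemma contDiffAt_locField_of_mfderiv_eq (hf : IsIsometricImmersion (d := d) (m := m) f)
    {V : Π p : N, TangentSpace (𝓡 d) p}
    (hV : ContDiffAt ℝ ∞ (locField (f x) V) (extChartAt (𝓡 d) (f x) (f x)))
    {Z : Π y : M, TangentSpace (𝓡 m) y}
    (hZ : ∀ y, mfderiv (𝓡 m) (𝓡 d) f y (Z y) = V (f y)) :
    ContDiffAt ℝ ∞ (locField x Z) (extChartAt (𝓡 m) x x) := by
  have hx : x ∈ chartNhd d m f x := self_mem_chartNhd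
  have hF := contDiffAt_locMap hf.1 hx
  have hDF : ContDiffAt ℝ ∞ (fderiv ℝ (locMap (d := d) f x)) (extChartAt (𝓡 m) x x) :=
    hF.fderiv_right (by simp)
  have hinj : LinearMap.ker (fderiv ℝ (locMap (d := d) f x)
      (extChartAt (𝓡 m) x x)).toLinearMap = ⊥ := by
    refine LinearMap.ker_eq_bot'.2 fun w hw ↦ ?_
    have h := tcoord_mfderiv hf.1 hx (tvec x x w)
    rw [tcoord_tvec hx.1] at h
    have h2 := (h.trans hw).trans (tcoord (d := d) (f x) (f x)).map_zero.symm
    have h3 := hf.injective_mfderiv x ((tcoord_injective hx.2 h2).trans (map_zero _).symm)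
    rw [← tcoord_tvec hx.1 w, h3, map_zero]
  -- A fixed left inverse of the differential at `x`. Its composite with the differential at nearby
  -- points is close to the identity, hence invertible, and so the tangent components of `V` are
  -- recovered smoothly.
  obtain ⟨L, hL⟩ := LinearMap.exists_leftInverse_of_injective _ hinj
  set L' := LinearMap.toContinuousLinearMap L with hL'
  have hB : ContDiffAt ℝ ∞ (fun a ↦ L' ∘L fderiv ℝ (locMap f x) a) (extChartAt (𝓡 m) x x) :=
    contDiffAt_const.clm_comp hDF
  have hB0 : L' ∘L fderiv ℝ (locMap f x) (extChartAt (𝓡 m) x x) =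
      (ContinuousLinearEquiv.refl ℝ (EuclideanSpace ℝ (Fin m)) :
        EuclideanSpace ℝ (Fin m) →L[ℝ] EuclideanSpace ℝ (Fin m)) := by
    ext1 v
    exact LinearMap.congr_fun hL v
  rw [← locMap_apply hx] at hV
  have hs : ContDiffAt ℝ ∞ (fun a ↦ (L' ∘L fderiv ℝ (locMap f x) a).inverse
      (L' (locField (f x) V (locMap f x a)))) (extChartAt (𝓡 m) x x) := by
    refine ContDiffAt.clm_apply ?_ (L'.contDiff.contDiffAt.comp _ (hV.comp _ hF))
    refine ContDiffAt.comp _ (g := ContinuousLinearMap.inverse) ?_ hB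
    rw [hB0]
    exact contDiffAt_map_inverse _
  refine hs.congr_of_eventuallyEq ?_
  have hn := ContinuousLinearEquiv.nhds
    (ContinuousLinearEquiv.refl ℝ (EuclideanSpace ℝ (Fin m)))
  rw [← hB0] at hn
  filter_upwards [hB.continuousAt.preimage_mem_nhds hn,
    eventually_chartNhd hf.1.continuous hx] with a ha hb
  obtain ⟨e, he⟩ := ha
  have h := tcoord_mfderiv hf.1 hb.2 (Z ((extChartAt (𝓡 m) x).symm a))
  rw [hZ, (extChartAt (𝓡 m) x).right_inv hb.1] at h
  have h2 : locField (f x) V (locMap f x a) = fderiv ℝ (locMap f x) a (locField x Z a) :=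
    (locField_apply V hb.2.2).trans h
  have h3 : L' (fderiv ℝ (locMap f x) a (locField x Z a)) = e (locField x Z a) :=
    (congrArg (fun B ↦ B (locField x Z a)) he).symm
  have h4 : (e : EuclideanSpace ℝ (Fin m) →L[ℝ] EuclideanSpace ℝ (Fin m)) =
    L' ∘L fderiv ℝ (locMap f x) a := he
  rw [h2, h3, ← h4, ContinuousLinearMap.inverse_equiv]
  simp

end Pullback

/-! ### Invariant submanifolds: curvature and second fundamental form along $\xi$. -/

section InvariantSubmanifold

variable {d m : ℕ}
  {N : Type*} [TopologicalSpace N] [ChartedSpace (EuclideanSpace ℝ (Fin d)) N]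
  [IsManifold (𝓡 d) ∞ N]
  [RiemannianBundle (fun p : N ↦ TangentSpace (𝓡 d) p)]
  {M : Type*} [TopologicalSpace M] [ChartedSpace (EuclideanSpace ℝ (Fin m)) M]
  [RiemannianBundle (fun x : M ↦ TangentSpace (𝓡 m) x)]
  {A : AlmostContactMetricStructure d N} {f : M → N} {Z : Π y : M, TangentSpace (𝓡 m) y} {x : M}

lemma inner_lift (hf : IsIsometricImmersion (d := d) (m := m) f)
    (hZ : ∀ y, mfderiv (𝓡 m) (𝓡 d) f y (Z y) = A.ξ (f y)) (u : TangentSpace (𝓡 m) x) :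
    A.η (f x) (mfderiv (𝓡 m) (𝓡 d) f x u) = inner ℝ u (Z x) := by
  rw [A.η_eq, ← hZ, hf.2]

lemma inner_lift_self (hf : IsIsometricImmersion (d := d) (m := m) f)
    (hZ : ∀ y, mfderiv (𝓡 m) (𝓡 d) f y (Z y) = A.ξ (f y)) (x : M) :
    (inner ℝ (Z x) (Z x) : ℝ) = 1 := by
  rw [← hf.2, hZ, A.inner_ξ_ξ]

variable [IsManifold (𝓡 m) ∞ M]

lemma contDiffAt_locField_lift (hf : IsIsometricImmersion (d := d) (m := m) f)
    (hZ : ∀ y, mfderiv (𝓡 m) (𝓡 d) f y (Z y) = A.ξ (f y)) :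
    ContDiffAt ℝ ∞ (locField x Z) (extChartAt (𝓡 m) x x) :=
  contDiffAt_locField_of_mfderiv_eq hf (A.contDiffAt_locField_ξ (f x)) hZ

variable [IsContMDiffRiemannianBundle (𝓡 d) ∞ (EuclideanSpace ℝ (Fin d))
    (fun p : N ↦ TangentSpace (𝓡 d) p)]
  [IsContMDiffRiemannianBundle (𝓡 m) ∞ (EuclideanSpace ℝ (Fin m))
    (fun p : M ↦ TangentSpace (𝓡 m) p)]
  {covN : AffineConnection d N} {covM : AffineConnection m M}

/-- The restriction of the characteristic field of a trans-Sasakian structure to an invariant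
submanifold. -/
lemma secondFundamentalForm_lift (hcovN : IsLeviCivita covN) (hcovM : IsLeviCivita covM)
    (hA : A.IsTransSasakian covN) (hf : IsIsometricImmersion (d := d) (m := m) f)
    (hinv : IsInvariantSubmanifold (m := m) A f)
    (hZ : ∀ y, mfderiv (𝓡 m) (𝓡 d) f y (Z y) = A.ξ (f y)) (u : TangentSpace (𝓡 m) x) :
    secondFundamentalForm covN f x u (Z x) = 0 ∧
      mfderiv (𝓡 m) (𝓡 d) f x (covM Z x u) = covN A.ξ (f x) (mfderiv (𝓡 m) (𝓡 d) f x u) := by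
  obtain ⟨α, β, h⟩ := hA
  have h1 := covAlong_mfderiv hcovN hcovM hf
    ((contDiffAt_locField_lift (x := x) hf hZ).differentiableAt (by simp)) u
  rw [funext hZ, covAlong_comp covN hf.1
    ((A.contDiffAt_locField_ξ (f x)).differentiableAt (by simp))] at h1
  -- By `cov_ξ` this vector is a combination of $u$, $\xi$ and $\phi u$, all tangent by invariance;
  -- its normal component $\sigma(u,\xi)$ must therefore vanish.
  have hmem : covN A.ξ (f x) (mfderiv (𝓡 m) (𝓡 d) f x u) ∈ tangentRange (m := m) f x := by
    rw [A.cov_ξ hcovN (h (f x))]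
    have hu : mfderiv (𝓡 m) (𝓡 d) f x u ∈ tangentRange (m := m) f x := LinearMap.mem_range_self _ u
    exact Submodule.sub_mem _ (Submodule.smul_mem _ _ (Submodule.sub_mem _ hu
      (Submodule.smul_mem _ _ (hinv x).1))) (Submodule.smul_mem _ _ ((hinv x).2 _ hu))
  have h0 : secondFundamentalForm covN f x u (Z x) = 0 := by
    refine eq_zero_of_normal_of_mem_range (m := m) (inner_secondFundamentalForm u (Z x)) ?_
    rw [← sub_eq_iff_eq_add] at h1
    rw [← h1]
    exact Submodule.sub_mem _ hmem (LinearMap.mem_range_self _ _)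
  exact ⟨h0, by rw [h1, h0, zero_add]⟩

/-- The curvature of an invariant submanifold in the direction of the characteristic field. -/
lemma curvature_lift (hcovN : IsLeviCivita covN) (hcovM : IsLeviCivita covM)
    {f₁ f₂ f₃ : N → ℝ} (hS : A.IsGeneralizedSasakianSpaceForm covN f₁ f₂ f₃)
    (hA : A.IsTransSasakian covN) (hf : IsIsometricImmersion (d := d) (m := m) f)
    (hinv : IsInvariantSubmanifold (m := m) A f)
    (hZ : ∀ y, mfderiv (𝓡 m) (𝓡 d) f y (Z y) = A.ξ (f y)) (u v : TangentSpace (𝓡 m) x) :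
    curvature covM x u v (Z x) =
      (f₁ (f x) - f₃ (f x)) • ((inner ℝ v (Z x) : ℝ) • u - (inner ℝ u (Z x) : ℝ) • v) := by
  have hx := mem_extChartAt_source (I := 𝓡 m) x
  have hZs := contDiffAt_locField_lift (x := x) hf hZ
  have hΓ := hcovM.differentiableAt_christoffel x
  have hG (v : TangentSpace (𝓡 m) x) := covAlong_mfderiv hcovN hcovM hf
    (W := fun y ↦ covM Z y (extendVec v y))
    ((hasFDerivAt_locCov hΓ (hZs.of_le (by norm_cast)) (tcoord x x v) 0).1.congr_of_eventuallyEq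
      (locField_cov_eventuallyEq covM ((extChartAt (𝓡 m) x).map_source hx) hZs v))
  have hG' (v : TangentSpace (𝓡 m) x) : (fun y ↦ mfderiv (𝓡 m) (𝓡 d) f y
      (covM Z y (extendVec v y))) = fun y ↦ covN A.ξ (f y)
        (mfderiv (𝓡 m) (𝓡 d) f y (extendVec v y)) :=
    funext fun y ↦ (secondFundamentalForm_lift hcovN hcovM hA hf hinv hZ _).2
  have hR := covAlong_cov_sub covN hf.1 (hcovN.differentiableAt_christoffel (f x))
    (A.contDiffAt_locField_ξ (f x)) u v
  rw [← hG', ← hG', hG, hG, A.curvature_ξ hS, inner_lift hf hZ, inner_lift hf hZ] at hR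
  set X := (f₁ (f x) - f₃ (f x)) • ((inner ℝ v (Z x) : ℝ) • u - (inner ℝ u (Z x) : ℝ) • v) with hX
  have hX' : mfderiv (𝓡 m) (𝓡 d) f x X = (f₁ (f x) - f₃ (f x)) •
      ((inner ℝ v (Z x) : ℝ) • mfderiv (𝓡 m) (𝓡 d) f x u
        - (inner ℝ u (Z x) : ℝ) • mfderiv (𝓡 m) (𝓡 d) f x v) := by
    simp only [hX, map_smul, map_sub]
  rw [← hX'] at hR
  have hC := congrArg (mfderiv (𝓡 m) (𝓡 d) f x) (curvature_eq covM hΓ hZs u v)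
  rw [map_sub] at hC
  -- The normal part of $\widetilde R(u,v)\xi$. It vanishes because the curvature formula makes
  -- $\widetilde R(u,v)\xi$ tangent, and comparing tangent parts then gives the claim.
  set s := secondFundamentalForm covN f x u (covM Z x (extendVec v x))
    - secondFundamentalForm covN f x v (covM Z x (extendVec u x)) with hs
  have hsum : s + mfderiv (𝓡 m) (𝓡 d) f x (curvature covM x u v (Z x)) =
      mfderiv (𝓡 m) (𝓡 d) f x X := by
    rw [← hR, hC, hs]
    abel
  have hs0 : s = 0 := by
    refine eq_zero_of_normal_of_mem_range (m := m) (fun t ↦ ?_) ?_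
    · rw [hs, inner_sub_left, inner_secondFundamentalForm, inner_secondFundamentalForm, sub_zero]
    · rw [← eq_sub_iff_add_eq] at hsum
      rw [hsum, ← map_sub]
      exact LinearMap.mem_range_self _ _
  rw [hs0, zero_add] at hsum
  exact hf.injective_mfderiv x hsum

/-- The Ricci tensor of an invariant submanifold in the direction of the characteristic field. -/
lemma ricci_lift (hcovN : IsLeviCivita covN) (hcovM : IsLeviCivita covM)
    {f₁ f₂ f₃ : N → ℝ} (hS : A.IsGeneralizedSasakianSpaceForm covN f₁ f₂ f₃)
    (hA : A.IsTransSasakian covN) (hf : IsIsometricImmersion (d := d) (m := m) f)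
    (hinv : IsInvariantSubmanifold (m := m) A f)
    (hZ : ∀ y, mfderiv (𝓡 m) (𝓡 d) f y (Z y) = A.ξ (f y)) (v : TangentSpace (𝓡 m) x) :
    ricci covM x v (Z x) = (f₁ (f x) - f₃ (f x)) * ((m - 1) * inner ℝ v (Z x)) := by
  have hm : Module.finrank ℝ (TangentSpace (𝓡 m) x) = m :=
    finrank_euclideanSpace_fin (𝕜 := ℝ) (n := m)
  have h (i) : inner ℝ (curvature covM x (stdOrthonormalBasis ℝ (TangentSpace (𝓡 m) x) i) v (Z x))
      (stdOrthonormalBasis ℝ (TangentSpace (𝓡 m) x) i) = (f₁ (f x) - f₃ (f x)) *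
      (inner ℝ v (Z x) - inner ℝ v (stdOrthonormalBasis ℝ (TangentSpace (𝓡 m) x) i) *
        inner ℝ (stdOrthonormalBasis ℝ (TangentSpace (𝓡 m) x) i) (Z x)) := by
    rw [curvature_lift hcovN hcovM hS hA hf hinv hZ, real_inner_smul_left, inner_sub_left,
      real_inner_smul_left, real_inner_smul_left, real_inner_self_eq_norm_sq,
      OrthonormalBasis.norm_eq_one]
    ring
  simp only [ricci, h]
  -- The constant terms contribute $m\,g(v,\xi)$ and Parseval removes one copy, whence the factor
  -- $m-1$.
  rw [← Finset.mul_sum, Finset.sum_sub_distrib, OrthonormalBasis.sum_inner_mul_inner]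
  simp only [Finset.sum_const, Finset.card_univ, Fintype.card_fin, hm, nsmul_eq_mul]
  ring

/-- With the lift of $\xi$ as extension of its own value, $\sigma(\cdot,\xi)$ is identically zero,
so only the term that differentiates $\xi$ remains. -/
lemma covDerivSecond_lift (hcovN : IsLeviCivita covN) (hcovM : IsLeviCivita covM)
    (hA : A.IsTransSasakian covN) (hf : IsIsometricImmersion (d := d) (m := m) f)
    (hinv : IsInvariantSubmanifold (m := m) A f)
    (hZ : ∀ y, mfderiv (𝓡 m) (𝓡 d) f y (Z y) = A.ξ (f y)) (u v : TangentSpace (𝓡 m) x) :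
    covDerivSecond covN covM f x u v (Z x) =
      - secondFundamentalForm covN f x v (covM Z x u) := by
  have h0 (y : M) (w : TangentSpace (𝓡 m) y) : secondFundamentalForm covN f y w (Z y) = 0 :=
    (secondFundamentalForm_lift hcovN hcovM hA hf hinv hZ w).1
  rw [covDerivSecond_eq hcovN hcovM hf
    ((contDiffAt_locField_lift (x := x) hf hZ).differentiableAt (by simp))]
  simp only [h0, normalCov, covAlong_zero covN hf.1, normalPart_zero, sub_zero, zero_sub]

/-- If `σ(u, ∇_v ξ) = 0` for all `u, v`, at all points, then `σ = 0`. -/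
lemma secondFundamentalForm_eq_zero (hcovN : IsLeviCivita covN) (hcovM : IsLeviCivita covM)
    {f₁ f₂ f₃ : N → ℝ} (hS : A.IsGeneralizedSasakianSpaceForm covN f₁ f₂ f₃)
    (hA : A.IsTransSasakian covN) (hf : IsIsometricImmersion (d := d) (m := m) f)
    (hinv : IsInvariantSubmanifold (m := m) A f) (hne : ∀ x : M, f₁ (f x) ≠ f₃ (f x))
    (hZ : ∀ y, mfderiv (𝓡 m) (𝓡 d) f y (Z y) = A.ξ (f y))
    (h : ∀ (y : M) (u v : TangentSpace (𝓡 m) y),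
      secondFundamentalForm covN f y u (covM Z y v) = 0) :
    IsTotallyGeodesic (m := m) covN f := by
  intro x u₀ v₀
  by_contra hσ
  have h0 (y : M) (w : TangentSpace (𝓡 m) y) : secondFundamentalForm covN f y w (Z y) = 0 :=
    (secondFundamentalForm_lift hcovN hcovM hA hf hinv hZ w).1
  have hK (y : M) (w : TangentSpace (𝓡 m) y) := (secondFundamentalForm_lift hcovN hcovM hA hf hinv
    hZ w).2
  obtain ⟨α, β, hαβ⟩ := hA
  -- Nothing is known about the regularity of $\alpha$ and $\beta$, and the curvature at `x` needs
  -- $\nabla\xi=0$ on a neighbourhood. Openness of $\sigma\ne0$ provides one.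
  have hZ0 : ∀ᶠ y in 𝓝 x, covM Z y = 0 := by
    filter_upwards [eventually_exists_secondFundamentalForm_ne_zero hcovN hcovM hf hσ]
      with y ⟨u, v, huv⟩
    -- The endomorphism that $\phi$ induces on the tangent space of $M$.
    choose φ hφ using fun w : TangentSpace (𝓡 m) y ↦
      (hinv y).2 (mfderiv (𝓡 m) (𝓡 d) f y w) (LinearMap.mem_range_self _ w)
    have hφ' (w) : mfderiv (𝓡 m) (𝓡 d) f y (φ w) =
      A.φ (f y) (mfderiv (𝓡 m) (𝓡 d) f y w) := hφ w
    have hcov (w : TangentSpace (𝓡 m) y) : covM Z y w =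
        β (f y) • w + (-(β (f y) * inner ℝ w (Z y))) • Z y + (-α (f y)) • φ w := by
      refine hf.injective_mfderiv y ?_
      rw [hK, A.cov_ξ hcovN (hαβ (f y)), inner_lift hf hZ, ← hZ, ← hφ']
      simp only [map_add, map_smul]
      module
    have hφφ (w : TangentSpace (𝓡 m) y) : φ (φ w) = (-1 : ℝ) • w + (inner ℝ w (Z y) : ℝ) • Z y := by
      refine hf.injective_mfderiv y ?_
      rw [hφ', hφ', A.φ_φ, inner_lift hf hZ, ← hZ]
      simp only [map_add, map_smul]
      module
    have e1 := h y u v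
    have e2 := h y u (φ v)
    simp only [hcov, hφφ, secondFundamentalForm_add_right hcovN hcovM hf,
      secondFundamentalForm_smul_right hcovN hcovM hf, h0, smul_zero, add_zero] at e1 e2
    have e3 : (β (f y) * β (f y) + α (f y) * α (f y)) • secondFundamentalForm covN f y u v = 0 := by
      -- `e1` says $\beta\sigma(u,v)-\alpha\sigma(u,\phi v)=0$ and `e2` says $\beta\sigma(u,\phi
      -- v)+\alpha\sigma(u,v)=0$; in this combination the mixed terms cancel.
      have := congrArg₂ (fun a b ↦ β (f y) • a + α (f y) • b) e1 e2
      simp only [smul_zero, add_zero] at this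
      rw [← this]
      module
    have e4 := (smul_eq_zero.1 e3).resolve_right huv
    have e5 : β (f y) = 0 := by nlinarith [mul_self_nonneg (α (f y)), mul_self_nonneg (β (f y))]
    have e6 : α (f y) = 0 := by nlinarith [mul_self_nonneg (α (f y)), mul_self_nonneg (β (f y))]
    ext1 w
    rw [hcov, e5, e6]
    simp
  have hcurv (u : TangentSpace (𝓡 m) x) : curvature covM x u (Z x) (Z x) = 0 := by
    have hx := mem_extChartAt_source (I := 𝓡 m) x
    have hz (v : TangentSpace (𝓡 m) x) : covM (fun y ↦ covM Z y (extendVec v y)) x = 0 := by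
      rw [← Pi.zero_apply (M := fun x : M ↦ TangentSpace (𝓡 m) x →L[ℝ] TangentSpace (𝓡 m) x) x,
        ← covM.zero]
      have hev : ∀ᶠ y in 𝓝 x, covM Z y (extendVec v y) =
          (0 : Π y : M, TangentSpace (𝓡 m) y) y := by
        filter_upwards [hZ0] with y hy
        rw [hy]
        rfl
      have hd : MDifferentiableAt (𝓡 m) ((𝓡 m).prod 𝓘(ℝ, EuclideanSpace ℝ (Fin m)))
          (T% (0 : Π y : M, TangentSpace (𝓡 m) y)) x := mdifferentiableAt_zeroSection ..
      refine covM.isCovariantDerivativeOnUniv.congr_of_eventuallyEq (hd.congr_of_eventuallyEq ?_)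
        hd univ_mem hev
      filter_upwards [hev] with y hy
      rw [hy]
    rw [curvature_eq covM (hcovM.differentiableAt_christoffel x)
      (contDiffAt_locField_lift (x := x) hf hZ), hz, hz]
    simp
  -- The curvature formula gives $0=R(u,\xi)\xi=(f_1-f_3)(u-\eta(u)\xi)$, so $\xi$ spans the tangent
  -- space.
  have hu (u : TangentSpace (𝓡 m) x) : u = (inner ℝ u (Z x) : ℝ) • Z x := by
    have h1 := hcurv u
    rw [curvature_lift hcovN hcovM hS ⟨α, β, hαβ⟩ hf hinv hZ, inner_lift_self hf hZ, one_smul] at h1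
    exact sub_eq_zero.1 ((smul_eq_zero.1 h1).resolve_left (sub_ne_zero.2 (hne x)))
  apply hσ
  rw [hu v₀, secondFundamentalForm_smul_right hcovN hcovM hf, h0, smul_zero]

/-- If `T((U ∧_S V)ξ, ξ) = 0` for `T = ∇_X σ`, then `σ(U, ∇_X ξ) = 0`. -/
lemma secondFundamentalForm_cov_lift (hcovN : IsLeviCivita covN) (hcovM : IsLeviCivita covM)
    {f₁ f₂ f₃ : N → ℝ} (hS : A.IsGeneralizedSasakianSpaceForm covN f₁ f₂ f₃)
    (hA : A.IsTransSasakian covN) (hf : IsIsometricImmersion (d := d) (m := m) f)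
    (hinv : IsInvariantSubmanifold (m := m) A f) (hne : f₁ (f x) ≠ f₃ (f x))
    (hZ : ∀ y, mfderiv (𝓡 m) (𝓡 d) f y (Z y) = A.ξ (f y)) {u v : TangentSpace (𝓡 m) x}
    (h : covDerivSecond covN covM f x v (wedgeEndo (ricci covM x) u (Z x) (Z x)) (Z x) = 0) :
    secondFundamentalForm covN f x u (covM Z x v) = 0 := by
  have h0 (w : TangentSpace (𝓡 m) x) : secondFundamentalForm covN f x w (Z x) = 0 :=
    (secondFundamentalForm_lift hcovN hcovM hA hf hinv hZ w).1
  have hr (w : TangentSpace (𝓡 m) x) := ricci_lift hcovN hcovM hS hA hf hinv hZ w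
  have hcomm (v w : TangentSpace (𝓡 m) x) := secondFundamentalForm_comm hcovN hcovM hf v w
  -- For $m=1$ the Ricci tensor vanishes on $\xi$ and `h` is void, but then every vector is a
  -- multiple of $\xi$. Otherwise $(u\wedge_S\xi)\xi=S(\xi,\xi)u-S(u,\xi)\xi$, whose second term
  -- $\sigma$ ignores and whose first has a nonzero coefficient.
  by_cases hm : (m : ℝ) = 1
  · have hm' : Module.finrank ℝ (TangentSpace (𝓡 m) x) = 1 := by
      have : Module.finrank ℝ (TangentSpace (𝓡 m) x) = m :=
        finrank_euclideanSpace_fin (𝕜 := ℝ) (n := m)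
      rw [this]
      exact_mod_cast hm
    have hZx : Z x ≠ 0 := by
      intro hz
      have := inner_lift_self hf hZ x
      rw [hz, inner_zero_left] at this
      exact zero_ne_one this
    obtain ⟨c, hc⟩ := (finrank_eq_one_iff_of_nonzero' (Z x) hZx).1 hm' (covM Z x v)
    rw [← hc, secondFundamentalForm_smul_right hcovN hcovM hf, h0, smul_zero]
  · rw [covDerivSecond_lift hcovN hcovM hA hf hinv hZ, neg_eq_zero, hcomm, wedgeEndo, hr, hr,
      inner_lift_self hf hZ, sub_eq_add_neg, ← neg_smul,
      secondFundamentalForm_add_right hcovN hcovM hf,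
      secondFundamentalForm_smul_right hcovN hcovM hf,
      secondFundamentalForm_smul_right hcovN hcovM hf, h0, smul_zero, add_zero, hcomm] at h
    refine (smul_eq_zero.1 h).resolve_left (mul_ne_zero (sub_ne_zero.2 hne) ?_)
    rw [mul_one]
    exact sub_ne_zero.2 hm

end InvariantSubmanifold

end

/-! ### The equivalence, in both readings. -/

theorem theorem3p4 {n m : ℕ}
    {N : Type*} [TopologicalSpace N] [T2Space N] [SecondCountableTopology N]
    [ChartedSpace (EuclideanSpace ℝ (Fin (2 * n + 1))) N] [IsManifold (𝓡 (2 * n + 1)) ∞ N]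
    [RiemannianBundle (fun p : N ↦ TangentSpace (𝓡 (2 * n + 1)) p)]
    [IsContMDiffRiemannianBundle (𝓡 (2 * n + 1)) ∞ (EuclideanSpace ℝ (Fin (2 * n + 1)))
      (fun p : N ↦ TangentSpace (𝓡 (2 * n + 1)) p)]
    {M : Type*} [TopologicalSpace M] [T2Space M] [SecondCountableTopology M]
    [ChartedSpace (EuclideanSpace ℝ (Fin m)) M] [IsManifold (𝓡 m) ∞ M]
    [RiemannianBundle (fun x : M ↦ TangentSpace (𝓡 m) x)]
    [IsContMDiffRiemannianBundle (𝓡 m) ∞ (EuclideanSpace ℝ (Fin m))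
      (fun x : M ↦ TangentSpace (𝓡 m) x)]
    (covN : AffineConnection (2 * n + 1) N) (hcovN : IsLeviCivita covN)
    (covM : AffineConnection m M) (hcovM : IsLeviCivita covM)
    (A : AlmostContactMetricStructure (2 * n + 1) N) (f₁ f₂ f₃ : N → ℝ)
    (hA : A.IsGeneralizedSasakianSpaceForm covN f₁ f₂ f₃) (hA' : A.IsTransSasakian covN)
    (f : M → N) (hf : IsIsometricImmersion (d := 2 * n + 1) (m := m) f)
    (hinv : IsInvariantSubmanifold (m := m) A f)
    (hne : ∀ x : M, f₁ (f x) ≠ f₃ (f x)) :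
    (IsTotallyGeodesic (m := m) covN f ↔
      ∀ (x : M) (Z : Fin 3 → TangentSpace (𝓡 m) x) (U V : TangentSpace (𝓡 m) x),
        tachibanaQ (ricci covM x)
          (fun Y : Fin 3 → TangentSpace (𝓡 m) x ↦ covDerivSecond covN covM f x (Y 0) (Y 1) (Y 2))
          Z U V = 0) ∧
    (IsTotallyGeodesic (m := m) covN f ↔
      ∀ (x : M) (X : TangentSpace (𝓡 m) x) (Z : Fin 2 → TangentSpace (𝓡 m) x)
        (U V : TangentSpace (𝓡 m) x),
        tachibanaQ (ricci covM x)
          (fun Y : Fin 2 → TangentSpace (𝓡 m) x ↦ covDerivSecond covN covM f x X (Y 0) (Y 1))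
          Z U V = 0) := by
  choose Z hZ using fun x ↦ (hinv x).1
  have hZ' : ∀ y, mfderiv (𝓡 m) (𝓡 (2 * n + 1)) f y (Z y) = A.ξ (f y) := hZ
  have h0 (x : M) (w : TangentSpace (𝓡 m) x) : secondFundamentalForm covN f x w (Z x) = 0 :=
    (secondFundamentalForm_lift hcovN hcovM hA' hf hinv hZ' w).1
  have hT (x : M) (u v : TangentSpace (𝓡 m) x) : covDerivSecond covN covM f x u v (Z x) =
      - secondFundamentalForm covN f x v (covM Z x u) :=
    covDerivSecond_lift hcovN hcovM hA' hf hinv hZ' u v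
  have hT0 (x : M) (u : TangentSpace (𝓡 m) x) : covDerivSecond covN covM f x u (Z x) (Z x) = 0 := by
    rw [hT, secondFundamentalForm_comm hcovN hcovM hf, h0, neg_zero]
  have hdouble {x : M} {w : TangentSpace (𝓡 (2 * n + 1)) (f x)} (h : w + w = 0) : w = 0 := by
    rw [← two_smul ℝ w] at h
    exact (smul_eq_zero.1 h).resolve_left two_ne_zero
  refine ⟨⟨fun h x W U V ↦ ?_, fun h ↦ ?_⟩, ⟨fun h x X W U V ↦ ?_, fun h ↦ ?_⟩⟩
  · simp only [tachibanaQ, covDerivSecond_eq_zero hf.1 h, Finset.sum_const_zero, neg_zero]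
  · refine secondFundamentalForm_eq_zero hcovN hcovM hA hA' hf hinv hne hZ' fun x u v ↦ ?_
    refine secondFundamentalForm_cov_lift hcovN hcovM hA hA' hf hinv (hne x) hZ' ?_
    -- The first-slot term vanishes by `hT0`, and the other two agree by the symmetry of
    -- $\widetilde\nabla_v\sigma$, so twice the desired quantity is zero.
    have h1 := h x ![v, Z x, Z x] u (Z x)
    simp only [tachibanaQ, Fin.sum_univ_three, neg_eq_zero] at h1
    simp [Function.update, hT0] at h1
    rw [covDerivSecond_comm hcovN hcovM hf v (Z x)] at h1
    exact hdouble h1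
  · simp only [tachibanaQ, covDerivSecond_eq_zero hf.1 h, Finset.sum_const_zero, neg_zero]
  · refine secondFundamentalForm_eq_zero hcovN hcovM hA hA' hf hinv hne hZ' fun x u v ↦ ?_
    refine secondFundamentalForm_cov_lift hcovN hcovM hA hA' hf hinv (hne x) hZ' ?_
    -- With the direction of differentiation fixed, only the two equal terms are present.
    have h1 := h x v ![Z x, Z x] u (Z x)
    simp only [tachibanaQ, Fin.sum_univ_two, neg_eq_zero] at h1
    simp [Function.update] at h1
    rw [covDerivSecond_comm hcovN hcovM hf v (Z x)] at h1
    exact hdouble h1
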